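/- Let $1\le K\le N$ and $T\ge 1$ be integers. A feasible decision is a pair $(S,\sigma)$ with $S\subseteq[N]$, $|S|\le K$ and $\sigma:S\to[K]$ injective. Let $v^\star_i\in(0,1]$ ($i\in[N]$) be unknown, and let the position effects $\theta^\star_k\in(0,1]$ ($k\in[K]$), with $\max_k\theta^\star_k=1$, and the revenues $r_i\in[0,1]$ ($i\in[N]$) be known. For $v\in[0,\infty)^N$ put $V(S,\sigma,v)=\sum_{j\in S}v_j\theta^\star_{\sigma(j)}$ and $R(S,\sigma,v)=\frac{\sum_{i\in S}r_iv_i\theta^\star_{\sigma(i)}}{1+V(S,\sigma,v)}$. In each round $t=1,\dots,T$ a policy $\pi$ picks, possibly at random, a feasible decision $(S_t,\sigma_t)$ from the past observations. Given the past and $(S_t,\sigma_t)$, the customer buys $i\in S_t$ with probability $\frac{v^\star_i\theta^\star_{\sigma_t(i)}}{1+V(S_t,\sigma_t,v^\star)}$ (then $i_t=i$), and buys nothing with probability $\frac{1}{1+V(S_t,\sigma_t,v^\star)}$ (then $i_t=0$). Let $$\mathrm{Regret}(T,\pi)=\mathbb E_\pi\Bigl[\sum_{t=1}^T\bigl(\max_{(S,\sigma)}R(S,\sigma,v^\star)-R(S_t,\sigma_t,v^\star)\bigr)\Bigr].$$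 Let $\theta^\star_{\min}=\min_k\theta^\star_k$, $V_{\max}=\max_{(S,\sigma)}V(S,\sigma,v^\star)$, $c=2(\lceil\log_2(T/\theta^\star_{\min})\rceil+1)$, $\delta=\frac{2}{3NT}$, $C_4=16$, $C_5=(200+32\sqrt6)/3$, $C_6=8+16\sqrt2$ and $C_7=(208+32\sqrt6+32\sqrt{42})/3$. The policy P2MLE-UCB is defined as follows. At the start of round $t$ let $n^t_{i,k}$ be the number of rounds $s<t$ with $i\in S_s$, $\sigma_s(i)=k$ and $i_s\in\{i,0\}$, let $w^t_{i,k}$ be the number of those with $i_s=i$, and let $D^t_i=\sum_kn^t_{i,k}\theta^\star_k$. If $D_i^t=0$, set $v_i^{t,\mathrm{ucb}}=1$. If $D_i^t>0$, let $\tilde v^t_i\ge0$ be the root of the strictly decreasing score function $v\mapsto\sum_{k=1}^K\bigl(w^t_{i,k}-n^t_{i,k}\frac{v\theta^\star_k}{1+v\theta^\star_k}\bigr)$ on $[0,\infty)$ (with $\tilde v^t_i=+\infty$ if there is no root), let $\hat v^t_i=\min(\tilde v^t_i,1)$, and set $$v_i^{t,\mathrm{ucb}}=\hat v^t_i+C_4\sqrt{\frac{\hat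 v^t_i\log(c/\delta)}{D^t_i}}+C_5\frac{\log(c/\delta)}{D^t_i}.$$ The policy offers a maximizer $(S_t,\sigma_t)$ of $R(S,\sigma,v^{t,\mathrm{ucb}})$ over all feasible $(S,\sigma)$, with ties broken arbitrarily. Theorem. For the policy $\pi$ = P2MLE-UCB, $$\mathrm{Regret}(T,\pi)\le 1+N\max\bigl\{2\log(3NT^2)(1+V_{\max})^2,\ 2K(1+V_{\max})\bigr\}+\tilde C\sqrt{NT},$$ where $$\tilde C=\Bigl(C_6(\theta^\star_{\min})^{-1/2}\sqrt{\log(3cNT/2)}+C_7(\theta^\star_{\min})^{-1}\log(3cNT/2)\Bigr)\sqrt{2(1+\log T)}.$$ -/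

import Mathlib

open scoped ENNReal NNReal

noncomputable section

namespace PositionMNL

/-- A feasible decision `(S, σ)`: an assortment `S ⊆ [N]` together with an injective assignment
`σ : S → [K]` of its products to positions (so that automatically `|S| ≤ K`). -/
abbrev Decision (N K : ℕ) : Type := Σ S : Finset (Fin N), (S ↪ Fin K)

/-- The empty assortment is feasible. -/
instance (N K : ℕ) : Nonempty (Decision N K) :=
  ⟨⟨∅, ⟨fun x => absurd x.2 (Finset.notMem_empty _), fun x => absurd x.2 (Finset.notMem_empty _)⟩⟩⟩

/-- A customer's choice: `some i` is the purchase of product `i`, `none` is the outside option. -/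
abbrev Choice (N : ℕ) : Type := Option (Fin N)

/-- Product `i` is displayed at position `k` under the decision `d`. -/
abbrev displayedAt {N K : ℕ} (d : Decision N K) (i : Fin N) (k : Fin K) : Prop :=
  ∃ hi : i ∈ d.1, d.2 ⟨i, hi⟩ = k

section Choice

variable {N K : ℕ}

/-- `∑_{j ∈ S} α_{j, σ(j)}`. -/
def totalAttraction (α : Fin N → Fin K → ℝ) (d : Decision N K) : ℝ :=
  ∑ j : d.1, α j (d.2 j)

/-- The multinomial logit choice probabilities `ℙ(· ∣ S, σ)`. -/
def choiceProb (α : Fin N → Fin K → ℝ) (d : Decision N K) : Choice N → ℝ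
  | none => 1 / (1 + totalAttraction α d)
  | some i => if hi : i ∈ d.1 then α i (d.2 ⟨i, hi⟩) / (1 + totalAttraction α d) else 0

/-- Expected revenue `R(S, σ) = ∑_{i ∈ S} r_i ℙ(i ∣ S, σ)`. -/
def revenue (r : Fin N → ℝ) (α : Fin N → Fin K → ℝ) (d : Decision N K) : ℝ :=
  ∑ i ∈ d.1, r i * choiceProb α d (some i)

/-- The optimal expected revenue `R(S⋆, σ⋆) = max_{(S, σ)} R(S, σ)` (over a finite nonempty set). -/
def optRevenue (r : Fin N → ℝ) (α : Fin N → Fin K → ℝ) : ℝ :=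
  ⨆ d : Decision N K, revenue r α d

theorem totalAttraction_nonneg {α : Fin N → Fin K → ℝ} (hα : ∀ i k, 0 ≤ α i k)
    (d : Decision N K) : 0 ≤ totalAttraction α d :=
  Finset.sum_nonneg fun _ _ => hα _ _

theorem choiceProb_nonneg {α : Fin N → Fin K → ℝ} (hα : ∀ i k, 0 ≤ α i k)
    (d : Decision N K) (c : Choice N) : 0 ≤ choiceProb α d c := by
  have h := totalAttraction_nonneg hα d
  cases c with
  | none => simp only [choiceProb]; positivity
  | some i =>
    simp only [choiceProb]
    split_ifs with hi
    · exact div_nonneg (hα _ _) (by linarith)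
    · exact le_rfl

theorem sum_choiceProb {α : Fin N → Fin K → ℝ} (hα : ∀ i k, 0 ≤ α i k)
    (d : Decision N K) : ∑ c, choiceProb α d c = 1 := by
  have h := totalAttraction_nonneg hα d
  have key : ∑ i : Fin N, choiceProb α d (some i)
      = totalAttraction α d / (1 + totalAttraction α d) := by
    rw [← Finset.sum_subset (Finset.subset_univ d.1)
      (fun i _ hi => by simp [choiceProb, hi]), ← Finset.sum_coe_sort d.1,
      totalAttraction, Finset.sum_div]
    exact Finset.sum_congr rfl fun i _ => by simp [choiceProb, totalAttraction]
  rw [Fintype.sum_option, key]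
  simp only [choiceProb]
  rw [← add_div]
  exact div_self (by linarith)

/-- The law of a customer's choice when the decision `d` is displayed. -/
def choicePMF (α : Fin N → Fin K → ℝ) (hα : ∀ i k, 0 ≤ α i k) (d : Decision N K) :
    PMF (Choice N) :=
  PMF.ofFintype (fun c => ENNReal.ofReal (choiceProb α d c)) (by
    rw [← ENNReal.ofReal_sum_of_nonneg fun c _ => choiceProb_nonneg hα d c,
      sum_choiceProb hα d, ENNReal.ofReal_one])

end Choice

/-- The decisions and choices of `t` rounds. The history available at the start of round `t + 1`
(rounds being numbered from `1`) is a `History N K t`. -/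
abbrev History (N K t : ℕ) : Type := Fin t → Decision N K × Choice N

/-- An admissible, possibly randomized, policy: given the observations from the first `t` rounds,
it returns the law of the next decision. -/
abbrev Policy (N K : ℕ) : Type := (t : ℕ) → History N K t → PMF (Decision N K)

/-- The law of the first `t` rounds of interaction, when decisions are made by `π` and, given
the past and the current decision, choices follow the logit model with attractions `α`. -/
def historyLaw {N K : ℕ} (α : Fin N → Fin K → ℝ) (hα : ∀ i k, 0 ≤ α i k) (π : Policy N K) :
    (t : ℕ) → PMF (History N K t)
  | 0 => PMF.pure Fin.elim0
  | t + 1 => (historyLaw α hα π t).bind fun h => (π t h).bind fun d =>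
      (choicePMF α hα d).map fun c =>
        Fin.snoc (α := fun _ => Decision N K × Choice N) h (d, c)

/-- `Regret(T, π)`, the expected cumulative regret over `T` rounds (the sample space is finite). -/
def regret {N K : ℕ} (r : Fin N → ℝ) (α : Fin N → Fin K → ℝ) (hα : ∀ i k, 0 ≤ α i k)
    (T : ℕ) (π : Policy N K) : ℝ :=
  ∑ h : History N K T, (historyLaw α hα π T h).toReal *
    ∑ s : Fin T, (optRevenue r α - revenue r α (h s).1)

/-- An instance of the multinomial logit model with multiplicative position effects. -/
structure Model (N K : ℕ) where
  /-- intrinsic attractions `v⋆` -/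
  v : Fin N → ℝ
  /-- position effects `θ⋆` -/
  θ : Fin K → ℝ
  /-- revenues -/
  r : Fin N → ℝ
  v_mem : ∀ i, v i ∈ Set.Ioc (0 : ℝ) 1
  θ_mem : ∀ k, θ k ∈ Set.Ioc (0 : ℝ) 1
  /-- the normalization `max_k θ⋆_k = 1` -/
  θ_max : ∃ k, θ k = 1
  r_mem : ∀ i, r i ∈ Set.Icc (0 : ℝ) 1

/-- `α_{i,k} = v_i θ_k`. -/
def attraction {N K : ℕ} (v : Fin N → ℝ) (θ : Fin K → ℝ) (i : Fin N) (k : Fin K) : ℝ :=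
  v i * θ k

/-- `θ_min = min_k θ_k`. -/
def thetaMin {K : ℕ} (θ : Fin K → ℝ) : ℝ := ⨅ k, θ k

namespace Model

variable {N K : ℕ} (M : Model N K)

/-- The true attractions `v⋆_i θ⋆_k`. -/
def α : Fin N → Fin K → ℝ := attraction M.v M.θ

theorem α_nonneg (i : Fin N) (k : Fin K) : 0 ≤ M.α i k :=
  mul_nonneg (M.v_mem i).1.le (M.θ_mem k).1.le

/-- `V_max = max_{(S, σ)} ∑_{i ∈ S} v⋆_i θ⋆_{σ(i)}`. -/
def Vmax : ℝ := ⨆ d : Decision N K, totalAttraction M.α d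

end Model

/-! ### The policy P2MLE-UCB

Everything in this section is computed from the horizon `T`, the known position effects `θ`, the
known revenues `r` and the observed history only. -/

section Algorithm

variable {N K t : ℕ}

/-- `n_{i,k}`: the number of rounds in which `i` was displayed at `k` and the customer bought `i`
or nothing. -/
def pairCount (h : History N K t) (i : Fin N) (k : Fin K) : ℕ :=
  (Finset.univ.filter fun s : Fin t =>
    ((h s).2 = some i ∨ (h s).2 = none) ∧ displayedAt (h s).1 i k).card

/-- `w_{i,k}`: the number of rounds in which `i` was displayed at `k` and bought. -/
def winCount (h : History N K t) (i : Fin N) (k : Fin K) : ℕ :=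
  (Finset.univ.filter fun s : Fin t => (h s).2 = some i ∧ displayedAt (h s).1 i k).card

/-- The effective exposure `D_i = ∑_k n_{i,k} θ_k`. -/
def exposure (θ : Fin K → ℝ) (h : History N K t) (i : Fin N) : ℝ :=
  ∑ k, (pairCount h i k : ℝ) * θ k

/-- The score function `S_i(x) = ∑_k (w_{i,k} - n_{i,k} p_k(x))`, `p_k(x) = x θ_k / (1 + x θ_k)`. -/
def score (θ : Fin K → ℝ) (h : History N K t) (i : Fin N) (x : ℝ) : ℝ :=
  ∑ k, ((winCount h i k : ℝ) - (pairCount h i k : ℝ) * (x * θ k / (1 + x * θ k)))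

/-- The pairwise MLE: the nonnegative root of the score function. If the exposure is positive, there
is at most one root, and there is none exactly if every relevant observation was a purchase; the
score is then positive everywhere, the likelihood increases in `x`, and the estimate is `∞`. -/
def pairwiseMLE (θ : Fin K → ℝ) (h : History N K t) (i : Fin N) : ℝ≥0∞ :=
  ⨅ (x : ℝ≥0) (_ : score θ h i x = 0), (x : ℝ≥0∞)

/-- The clipped MLE: the minimum of the pairwise MLE and `1`. -/
def clippedMLE (θ : Fin K → ℝ) (h : History N K t) (i : Fin N) : ℝ :=
  (min (pairwiseMLE θ h i) 1).toReal

def C₁ : ℝ := 8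
def C₂ : ℝ := 8 / 3
def C₃ : ℝ := 56 / 3
def C₄ : ℝ := 2 * C₁
def C₅ : ℝ := C₁ ^ 2 + C₂ + 2 * C₁ * √C₂
def C₆ : ℝ := √2 * C₄ + C₁
def C₇ : ℝ := C₄ * √C₃ + C₅ + C₂

/-- `c = 2 (⌈log₂ (T / θ_min)⌉ + 1)`. -/
def peelConst (T : ℕ) (θ : Fin K → ℝ) : ℝ :=
  2 * ((⌈Real.logb 2 (T / thetaMin θ)⌉ : ℝ) + 1)

/-- The confidence parameter `δ = 2 / (3 N T)`. -/
def confidence (N T : ℕ) : ℝ := 2 / (3 * N * T)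

/-- The upper confidence bound `v_i^{ucb}` computed from the history `h`. -/
def ucb (T : ℕ) (θ : Fin K → ℝ) (h : History N K t) (i : Fin N) : ℝ :=
  if 0 < exposure θ h i then
    clippedMLE θ h i
      + C₄ * √(clippedMLE θ h i * Real.log (peelConst T θ / confidence N T) / exposure θ h i)
      + C₅ * (Real.log (peelConst T θ / confidence N T) / exposure θ h i)
  else 1

/-- `π` is an implementation of P2MLE-UCB for horizon `T`: in every round `1, …, T` it only offers
maximizers of `R(·, ·, v^{ucb}, θ)`. Ties may be broken arbitrarily, also at random. -/
def IsP2MLEUCB (T : ℕ) (θ : Fin K → ℝ) (r : Fin N → ℝ) (π : Policy N K) : Prop :=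
  ∀ t < T, ∀ h : History N K t, ∀ d ∈ (π t h).support, ∀ d' : Decision N K,
    revenue r (attraction (ucb T θ h) θ) d' ≤ revenue r (attraction (ucb T θ h) θ) d

/-- The factor `C̃` of `√(N T)` in the regret bound. -/
def Ctilde (N T : ℕ) (θ : Fin K → ℝ) : ℝ :=
  (C₆ * (thetaMin θ) ^ (-(1 / 2) : ℝ) * √(Real.log (3 * peelConst T θ * N * T / 2))
    + C₇ * (thetaMin θ)⁻¹ * Real.log (3 * peelConst T θ * N * T / 2))
    * √(2 * (1 + Real.log T))

end Algorithm

end PositionMNL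

end

open scoped ENNReal NNReal

noncomputable section

namespace PositionMNL

/-! ### Expectations along the interaction and potential arguments -/

section Expectation

theorem sum_bind_toReal_mul {β γ : Type*} [Fintype β] [Fintype γ] (p : PMF β)
    (f : β → PMF γ) (g : γ → ℝ) :
    ∑ b, (p.bind f b).toReal * g b = ∑ a, (p a).toReal * ∑ b, (f a b).toReal * g b := by
  have h : ∀ b, (p.bind f b).toReal = ∑ a, (p a).toReal * (f a b).toReal := fun b => by
    rw [PMF.bind_apply, tsum_fintype, ENNReal.toReal_sum fun a _ =>
      ENNReal.mul_ne_top (p.apply_ne_top a) ((f a).apply_ne_top b)]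
    simp
  simp_rw [h, Finset.sum_mul, Finset.mul_sum]
  rw [Finset.sum_comm]
  simp_rw [mul_assoc]

theorem sum_map_toReal_mul {β γ : Type*} [Fintype β] [Fintype γ] (p : PMF β)
    (f : β → γ) (g : γ → ℝ) :
    ∑ b, (p.map f b).toReal * g b = ∑ a, (p a).toReal * g (f a) := by
  classical
  rw [← PMF.bind_pure_comp, sum_bind_toReal_mul]
  refine Finset.sum_congr rfl fun a _ => ?_
  congr 1
  rw [Finset.sum_eq_single (f a)] <;> simp +contextual [PMF.pure_apply]

theorem sum_pmf_toReal {β : Type*} [Fintype β] (p : PMF β) : ∑ b, (p b).toReal = 1 := by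
  rw [← ENNReal.toReal_sum fun a _ => p.apply_ne_top a, ← tsum_fintype (L := .unconditional β), p.tsum_coe]
  simp

variable {N K : ℕ} (α : Fin N → Fin K → ℝ) (hα : ∀ i k, 0 ≤ α i k) (π : Policy N K)

/-- The history after one more round. -/
def extend {t : ℕ} (h : History N K t) (d : Decision N K) (c : Choice N) : History N K (t + 1) :=
  Fin.snoc (α := fun _ => Decision N K × Choice N) h (d, c)

/-- The expectation of a function of the first `t` rounds. -/
def histMean (t : ℕ) (f : History N K t → ℝ) : ℝ :=
  ∑ h, (historyLaw α hα π t h).toReal * f h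

/-- The expectation of a function of the first `t` rounds and of the next decision. -/
def roundMean (t : ℕ) (g : History N K t → Decision N K → ℝ) : ℝ :=
  histMean α hα π t fun h => ∑ d, (π t h d).toReal * g h d

theorem histMean_mono {t : ℕ} {f g : History N K t → ℝ} (hfg : ∀ h, f h ≤ g h) :
    histMean α hα π t f ≤ histMean α hα π t g :=
  Finset.sum_le_sum fun h _ => mul_le_mul_of_nonneg_left (hfg h) ENNReal.toReal_nonneg

theorem histMean_const (t : ℕ) (a : ℝ) : histMean α hα π t (fun _ => a) = a := by
  rw [histMean, ← Finset.sum_mul, sum_pmf_toReal, one_mul]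

theorem histMean_add (t : ℕ) (f g : History N K t → ℝ) :
    histMean α hα π t (fun h => f h + g h) = histMean α hα π t f + histMean α hα π t g := by
  simp only [histMean, mul_add, Finset.sum_add_distrib]

theorem histMean_const_mul (t : ℕ) (a : ℝ) (f : History N K t → ℝ) :
    histMean α hα π t (fun h => a * f h) = a * histMean α hα π t f := by
  simp only [histMean, Finset.mul_sum]
  exact Finset.sum_congr rfl fun _ _ => by ring

theorem histMean_sum {ι : Type*} (s : Finset ι) (t : ℕ) (f : ι → History N K t → ℝ) :
    histMean α hα π t (fun h => ∑ j ∈ s, f j h) = ∑ j ∈ s, histMean α hα π t (f j) := by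
  simp only [histMean, Finset.mul_sum]
  rw [Finset.sum_comm]

theorem histMean_succ (t : ℕ) (f : History N K (t + 1) → ℝ) :
    histMean α hα π (t + 1) f =
      roundMean α hα π t fun h d => ∑ c, choiceProb α d c * f (extend h d c) := by
  rw [histMean, historyLaw, sum_bind_toReal_mul, roundMean, histMean]
  refine Finset.sum_congr rfl fun h _ => ?_
  rw [sum_bind_toReal_mul]
  congr 1
  refine Finset.sum_congr rfl fun d _ => ?_
  rw [sum_map_toReal_mul]
  congr 1
  refine Finset.sum_congr rfl fun c _ => ?_
  rw [choicePMF, PMF.ofFintype_apply, ENNReal.toReal_ofReal (choiceProb_nonneg hα d c)]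
  rfl

theorem roundMean_of_history (t : ℕ) (f : History N K t → ℝ) :
    roundMean α hα π t (fun h _ => f h) = histMean α hα π t f := by
  simp only [roundMean, ← Finset.sum_mul, sum_pmf_toReal, one_mul]

/-- The comparison is asked only on the support because optimality of the offered decision is known
only there. -/
theorem roundMean_mono {t : ℕ} {f g : History N K t → Decision N K → ℝ}
    (hfg : ∀ h, ∀ d ∈ (π t h).support, f h d ≤ g h d) :
    roundMean α hα π t f ≤ roundMean α hα π t g := by
  refine histMean_mono α hα π fun h => Finset.sum_le_sum fun d _ => ?_
  by_cases hd : d ∈ (π t h).support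
  · exact mul_le_mul_of_nonneg_left (hfg h d hd) ENNReal.toReal_nonneg
  · rw [PMF.mem_support_iff, not_not] at hd
    simp [hd]

theorem roundMean_add (t : ℕ) (f g : History N K t → Decision N K → ℝ) :
    roundMean α hα π t (fun h d => f h d + g h d) =
      roundMean α hα π t f + roundMean α hα π t g := by
  simp only [roundMean, mul_add, Finset.sum_add_distrib, histMean_add]

theorem roundMean_const_mul (t : ℕ) (a : ℝ) (f : History N K t → Decision N K → ℝ) :
    roundMean α hα π t (fun h d => a * f h d) = a * roundMean α hα π t f := by
  simp only [roundMean, ← histMean_const_mul, Finset.mul_sum]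
  congr 1
  funext h
  exact Finset.sum_congr rfl fun _ _ => by ring

theorem roundMean_sum {ι : Type*} (s : Finset ι) (t : ℕ)
    (f : ι → History N K t → Decision N K → ℝ) :
    roundMean α hα π t (fun h d => ∑ j ∈ s, f j h d) = ∑ j ∈ s, roundMean α hα π t (f j) := by
  simp only [roundMean, ← histMean_sum, Finset.mul_sum]
  congr 1
  funext h
  rw [Finset.sum_comm]

theorem roundMean_const (t : ℕ) (a : ℝ) : roundMean α hα π t (fun _ _ => a) = a := by
  rw [roundMean_of_history α hα π t fun _ => a, histMean_const]

/-- A potential whose conditional drift dominates `g` bounds the accumulated expectation of `g`. -/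
theorem sum_roundMean_le_of_potential (Φ : (t : ℕ) → History N K t → ℝ)
    (g : (t : ℕ) → History N K t → Decision N K → ℝ)
    (hstep : ∀ t h d, Φ t h + g t h d ≤ ∑ c, choiceProb α d c * Φ (t + 1) (extend h d c))
    (hzero : ∀ h, 0 ≤ Φ 0 h) (T : ℕ) :
    ∑ t ∈ Finset.range T, roundMean α hα π t (g t) ≤ histMean α hα π T (Φ T) := by
  induction T with
  | zero =>
    simpa [histMean_const] using histMean_mono α hα π (f := fun _ => 0) hzero
  | succ T ih =>
    rw [Finset.sum_range_succ, histMean_succ]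
    refine le_trans ?_ (roundMean_mono α hα π fun h d _ => hstep T h d)
    rw [roundMean_add, roundMean_of_history]
    linarith

/-- A process without positive conditional drift stays below its initial bound in expectation. -/
theorem histMean_le_of_supermartingale (X : (t : ℕ) → History N K t → ℝ) (a : ℝ)
    (hstep : ∀ t h d, ∑ c, choiceProb α d c * X (t + 1) (extend h d c) ≤ X t h)
    (hzero : ∀ h, X 0 h ≤ a) (t : ℕ) : histMean α hα π t (X t) ≤ a := by
  induction t with
  | zero => simpa [histMean_const] using histMean_mono α hα π (g := fun _ => a) hzero
  | succ t ih =>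
    rw [histMean_succ]
    refine le_trans (roundMean_mono α hα π fun h d _ => hstep t h d) ?_
    rwa [roundMean_of_history]

theorem regret_eq_sum_roundMean (r : Fin N → ℝ) (T : ℕ) :
    regret r α hα T π = ∑ t ∈ Finset.range T,
      roundMean α hα π t fun _ d => optRevenue r α - revenue r α d := by
  change histMean α hα π T _ = _
  induction T with
  | zero => simp [histMean]
  | succ T ih =>
    rw [Finset.sum_range_succ, ← ih, histMean_succ, ← roundMean_of_history, ← roundMean_add]
    congr 1
    funext h d
    simp only [extend, Fin.sum_univ_castSucc, Fin.snoc_castSucc, Fin.snoc_last]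
    rw [← Finset.sum_mul, sum_choiceProb hα, one_mul]

end Expectation

/-! ### Evolution of the counts, the exposure and the score -/

section Counting

variable {N K t : ℕ}

theorem displayedAt_iff {d : Decision N K} {i : Fin N} (hi : i ∈ d.1) (k : Fin K) :
    displayedAt d i k ↔ d.2 ⟨i, hi⟩ = k :=
  ⟨fun ⟨_, h⟩ => h, fun h => ⟨hi, h⟩⟩

theorem pairCount_extend (h : History N K t) (d : Decision N K) (c : Choice N) (i : Fin N)
    (k : Fin K) : pairCount (extend h d c) i k =
      pairCount h i k + if (c = some i ∨ c = none) ∧ displayedAt d i k then 1 else 0 := by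
  rw [pairCount, pairCount, Finset.card_filter, Finset.card_filter, Fin.sum_univ_castSucc]
  simp only [extend, Fin.snoc_castSucc, Fin.snoc_last]

theorem winCount_extend (h : History N K t) (d : Decision N K) (c : Choice N) (i : Fin N)
    (k : Fin K) : winCount (extend h d c) i k =
      winCount h i k + if c = some i ∧ displayedAt d i k then 1 else 0 := by
  rw [winCount, winCount, Finset.card_filter, Finset.card_filter, Fin.sum_univ_castSucc]
  simp only [extend, Fin.snoc_castSucc, Fin.snoc_last]

theorem pairCount_extend_of_notMem (h : History N K t) {d : Decision N K} (c : Choice N)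
    {i : Fin N} (hi : i ∉ d.1) (k : Fin K) : pairCount (extend h d c) i k = pairCount h i k := by
  simp [pairCount_extend, hi]

theorem winCount_extend_of_notMem (h : History N K t) {d : Decision N K} (c : Choice N)
    {i : Fin N} (hi : i ∉ d.1) (k : Fin K) : winCount (extend h d c) i k = winCount h i k := by
  simp [winCount_extend, hi]

theorem pairCount_extend_of_ne (h : History N K t) (d : Decision N K) {c : Choice N}
    {i : Fin N} (hc : c ≠ some i) (hc' : c ≠ none) (k : Fin K) :
    pairCount (extend h d c) i k = pairCount h i k := by
  simp [pairCount_extend, hc, hc']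

theorem winCount_extend_of_ne (h : History N K t) (d : Decision N K) {c : Choice N}
    {i : Fin N} (hc : c ≠ some i) (k : Fin K) :
    winCount (extend h d c) i k = winCount h i k := by
  simp [winCount_extend, hc]

/-- The number of rounds in which `i` was displayed and the customer bought `i` or nothing. -/
def obsCount (h : History N K t) (i : Fin N) : ℕ := ∑ k, pairCount h i k

theorem obsCount_extend (h : History N K t) {d : Decision N K} {c : Choice N} {i : Fin N}
    (hi : i ∈ d.1) (hc : c = some i ∨ c = none) :
    obsCount (extend h d c) i = obsCount h i + 1 := by
  simp [obsCount, pairCount_extend, Finset.sum_add_distrib, displayedAt_iff hi, hc]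

theorem exposure_extend (θ : Fin K → ℝ) (h : History N K t) {d : Decision N K} {c : Choice N}
    {i : Fin N} (hi : i ∈ d.1) (hc : c = some i ∨ c = none) :
    exposure θ (extend h d c) i = exposure θ h i + θ (d.2 ⟨i, hi⟩) := by
  simp [exposure, pairCount_extend, Finset.sum_add_distrib, displayedAt_iff hi, hc, add_mul]

theorem score_extend_some (θ : Fin K → ℝ) (h : History N K t) {d : Decision N K} {i : Fin N}
    (hi : i ∈ d.1) (x : ℝ) : score θ (extend h d (some i)) i x =
      score θ h i x + (1 - x * θ (d.2 ⟨i, hi⟩) / (1 + x * θ (d.2 ⟨i, hi⟩))) := by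
  simp only [score, pairCount_extend, winCount_extend]
  rw [← Finset.sum_erase_add _ _ (Finset.mem_univ (d.2 ⟨i, hi⟩)),
    ← Finset.sum_erase_add (a := d.2 ⟨i, hi⟩) _ _ (Finset.mem_univ _), add_assoc]
  congr 1
  · refine Finset.sum_congr rfl fun k hk => ?_
    have : d.2 ⟨i, hi⟩ ≠ k := (Finset.ne_of_mem_erase hk).symm
    simp [displayedAt_iff hi, this]
  · simp [displayedAt_iff hi]; ring

theorem score_extend_none (θ : Fin K → ℝ) (h : History N K t) {d : Decision N K} {i : Fin N}
    (hi : i ∈ d.1) (x : ℝ) : score θ (extend h d none) i x =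
      score θ h i x - x * θ (d.2 ⟨i, hi⟩) / (1 + x * θ (d.2 ⟨i, hi⟩)) := by
  simp only [score, pairCount_extend, winCount_extend]
  rw [← Finset.sum_erase_add _ _ (Finset.mem_univ (d.2 ⟨i, hi⟩)),
    ← Finset.sum_erase_add (a := d.2 ⟨i, hi⟩) _ _ (Finset.mem_univ _), add_sub_assoc]
  congr 1
  · refine Finset.sum_congr rfl fun k hk => ?_
    have : d.2 ⟨i, hi⟩ ≠ k := (Finset.ne_of_mem_erase hk).symm
    simp [displayedAt_iff hi, this]
  · simp [displayedAt_iff hi]; ring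

theorem obsCount_le (h : History N K t) (i : Fin N) : obsCount h i ≤ t := by
  induction t with
  | zero => simp [obsCount, pairCount]
  | succ t ih =>
    obtain ⟨h', d, c, rfl⟩ : ∃ h' d c, h = extend (t := t) h' d c :=
      ⟨Fin.init h, (h (Fin.last t)).1, (h (Fin.last t)).2, by simp [extend]⟩
    by_cases hi : i ∈ d.1
    · by_cases hc : c = some i ∨ c = none
      · rw [obsCount_extend h' hi hc]
        exact Nat.succ_le_succ (ih h')
      · push Not at hc
        simp only [obsCount, pairCount_extend_of_ne h' d hc.1 hc.2]
        exact (ih h').trans t.le_succ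
    · simp only [obsCount, pairCount_extend_of_notMem h' c hi]
      exact (ih h').trans t.le_succ

/-- Only a purchase of `i` or no purchase changes the statistics of `i`, so a conditional mean is
the unchanged value plus two corrections. -/
theorem sum_choiceProb_mul_eq {α : Fin N → Fin K → ℝ} (hα : ∀ i k, 0 ≤ α i k)
    (d : Decision N K) (i : Fin N) (f : Choice N → ℝ) (a : ℝ)
    (hf : ∀ c, c ≠ some i → c ≠ none → f c = a) :
    ∑ c, choiceProb α d c * f c = a + choiceProb α d none * (f none - a)
      + choiceProb α d (some i) * (f (some i) - a) := by
  have h : ∑ c, choiceProb α d c * f c = a + ∑ c, choiceProb α d c * (f c - a) := by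
    simp only [mul_sub, Finset.sum_sub_distrib, ← Finset.sum_mul, sum_choiceProb hα]
    ring
  rw [h, Fintype.sum_option, add_assoc, Finset.sum_eq_single i]
  · intro j _ hj
    rw [hf (some j) (by simpa using hj) (by simp)]
    simp
  · simp

end Counting

/-! ### Bernstein's exponential inequality -/

section Bernstein

theorem exp_sub_one_sub_le {x : ℝ} (hx : 0 ≤ x) (hx3 : x < 3) :
    Real.exp x - 1 - x ≤ x ^ 2 / (2 * (1 - x / 3)) := by
  -- Multiplied by `(1 - x / 3) * exp (-x)`, the claim becomes `f 0 ≤ f x`; the derivative of `f` is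
  -- nonnegative because `1 + y + y² / 2 ≤ exp y`.
  let f : ℝ → ℝ := fun y => Real.exp (-y) * (1 + 2 * y / 3 + y ^ 2 / 6) + y / 3
  have hd : ∀ y, HasDerivAt f (1 / 3 * (1 - Real.exp (-y) * (1 + y + y ^ 2 / 2))) y := fun y => by
    have h1 : HasDerivAt (fun y : ℝ => Real.exp (-y)) (Real.exp (-y) * (-1)) y :=
      (hasDerivAt_neg y).exp
    have h2 : HasDerivAt (fun y : ℝ => 1 + 2 * y / 3 + y ^ 2 / 6) (2 * 1 / 3 + 2 * y / 6) y := by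
      have := ((((hasDerivAt_id y).const_mul 2).div_const 3).const_add 1).add
        (((hasDerivAt_id y).pow 2).div_const 6)
      exact this.congr_deriv (by simp)
    refine ((h1.mul h2).add ((hasDerivAt_id y).div_const 3)).congr_deriv ?_
    ring
  have hmono : MonotoneOn f (Set.Ici 0) := by
    refine monotoneOn_of_deriv_nonneg (convex_Ici 0)
      (fun y _ => (hd y).continuousAt.continuousWithinAt)
      (fun y _ => (hd y).differentiableAt.differentiableWithinAt) fun y hy => ?_
    rw [interior_Ici, Set.mem_Ioi] at hy
    rw [(hd y).deriv]
    have h1 := Real.quadratic_le_exp_of_nonneg hy.le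
    have h2 : Real.exp (-y) * (1 + y + y ^ 2 / 2) ≤ Real.exp (-y) * Real.exp y :=
      mul_le_mul_of_nonneg_left h1 (Real.exp_pos _).le
    rw [← Real.exp_add, neg_add_cancel, Real.exp_zero] at h2
    linarith
  have h := hmono (Set.mem_Ici.2 le_rfl) (Set.mem_Ici.2 hx) hx
  simp only [f] at h
  norm_num at h
  have h3 : (1 - x / 3) * Real.exp x ≤ 1 + 2 * x / 3 + x ^ 2 / 6 := by
    have h4 : Real.exp (-x) * Real.exp x = 1 := by rw [← Real.exp_add, neg_add_cancel, Real.exp_zero]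
    have h5 := mul_le_mul_of_nonneg_right h (Real.exp_pos x).le
    nlinarith
  rw [le_div_iff₀ (by linarith)]
  nlinarith

/-- The exponent at which Bernstein's deviation bound is attained. -/
theorem exists_bernstein_exponent {W L : ℝ} (hW : 0 < W) (hL : 0 < L) :
    ∃ l : ℝ, 0 ≤ l ∧ ∀ y, √(2 * W * L) + L / 3 ≤ y →
      L ≤ l * y - (Real.exp l - 1 - l) * W := by
  set a := √W with ha
  set b := √(2 * L) with hb
  have ha0 : 0 < a := Real.sqrt_pos.2 hW
  have hb0 : 0 < b := Real.sqrt_pos.2 (by linarith)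
  have ha2 : a ^ 2 = W := Real.sq_sqrt hW.le
  have hb2 : b ^ 2 = 2 * L := Real.sq_sqrt (by linarith)
  have hab : √(2 * W * L) = a * b := by
    rw [ha, hb, ← Real.sqrt_mul hW.le]
    congr 1
    ring
  have hs : 0 < a + b / 3 := by positivity
  have hl3 : b / (a + b / 3) < 3 := by
    rw [div_lt_iff₀ hs]
    linarith
  -- With `a = √W` and `b = √(2L)` the variance term costs at most `l a b / 2`, and the rest at the
  -- threshold is `l (b / 2) (a + b / 3) = b² / 2 = L`.
  refine ⟨b / (a + b / 3), by positivity, fun y hy => ?_⟩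
  have h1 := exp_sub_one_sub_le (x := b / (a + b / 3)) (by positivity) hl3
  have h2 := mul_le_mul_of_nonneg_right h1 hW.le
  have h3 := mul_le_mul_of_nonneg_left hy (show 0 ≤ b / (a + b / 3) by positivity)
  have h4 : (b / (a + b / 3)) ^ 2 / (2 * (1 - b / (a + b / 3) / 3)) * W
      = b / (a + b / 3) * (a * b / 2) := by
    have : 1 - b / (a + b / 3) / 3 = a / (a + b / 3) := by
      field_simp
      ring
    rw [this, ← ha2]
    field_simp
  have h5 : b / (a + b / 3) * (√(2 * W * L) + L / 3) - b / (a + b / 3) * (a * b / 2) = L := by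
    have : L = b ^ 2 / 2 := by linarith
    rw [hab, this]
    field_simp
    ring
  linarith

end Bernstein

/-! ### Strong monotonicity of the score and the clipped estimate -/

section Score

variable {N K t : ℕ} {θ : Fin K → ℝ}

theorem thetaMin_le (θ : Fin K → ℝ) (k : Fin K) : thetaMin θ ≤ θ k :=
  ciInf_le (Set.finite_range θ).bddBelow k

theorem thetaMin_pos [Nonempty (Fin K)] (hθ : ∀ k, 0 < θ k) : 0 < thetaMin θ := by
  obtain ⟨k, hk⟩ := exists_eq_ciInf_of_finite (f := θ)
  rw [thetaMin, ← hk]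
  exact hθ k

theorem thetaMin_mul_obsCount_le (θ : Fin K → ℝ) (h : History N K t) (i : Fin N) :
    thetaMin θ * obsCount h i ≤ exposure θ h i := by
  rw [obsCount, exposure, Nat.cast_sum, Finset.mul_sum]
  refine Finset.sum_le_sum fun k _ => ?_
  rw [mul_comm]
  exact mul_le_mul_of_nonneg_left (thetaMin_le θ k) (Nat.cast_nonneg _)

theorem exposure_le_obsCount (hθ : ∀ k, θ k ≤ 1) (h : History N K t) (i : Fin N) :
    exposure θ h i ≤ obsCount h i := by
  rw [obsCount, exposure, Nat.cast_sum]
  exact Finset.sum_le_sum fun k _ => mul_le_of_le_one_right (Nat.cast_nonneg _) (hθ k)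

/-- Each `p_k` increases from `x` to `y` by `(y - x) θ_k / ((1 + x θ_k) (1 + y θ_k))`, and both
factors are at most `1 + B`. The choice `B = 1` yields the slope `D / 4`. -/
theorem le_score_sub_score (hθ : ∀ k, θ k ∈ Set.Ioc (0 : ℝ) 1) (h : History N K t) (i : Fin N)
    {x y B : ℝ} (hx : 0 ≤ x) (hxy : x ≤ y) (hy : y ≤ B) :
    (y - x) * exposure θ h i / (1 + B) ^ 2 ≤ score θ h i x - score θ h i y := by
  simp only [score, exposure]
  rw [← Finset.sum_sub_distrib, Finset.mul_sum, Finset.sum_div]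
  refine Finset.sum_le_sum fun k _ => ?_
  obtain ⟨h0, h1⟩ := hθ k
  have hy0 : 0 ≤ y := hx.trans hxy
  have hX : 0 < 1 + x * θ k := by positivity
  have hY : 0 < 1 + y * θ k := by positivity
  have e : y * θ k / (1 + y * θ k) - x * θ k / (1 + x * θ k)
      = (y - x) * θ k / ((1 + x * θ k) * (1 + y * θ k)) := by
    field_simp
    ring
  have hb : (1 + x * θ k) * (1 + y * θ k) ≤ (1 + B) ^ 2 := by
    rw [sq]
    have h2 := mul_le_of_le_one_right hx h1
    have h3 := mul_le_of_le_one_right hy0 h1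
    exact mul_le_mul (by linarith) (by linarith) hY.le (by linarith)
  have key : (y - x) * θ k / (1 + B) ^ 2
      ≤ y * θ k / (1 + y * θ k) - x * θ k / (1 + x * θ k) := by
    rw [e]
    exact div_le_div_of_nonneg_left (mul_nonneg (by linarith) h0.le) (by positivity) hb
  calc (y - x) * ((pairCount h i k : ℝ) * θ k) / (1 + B) ^ 2
      = pairCount h i k * ((y - x) * θ k / (1 + B) ^ 2) := by ring
    _ ≤ pairCount h i k * (y * θ k / (1 + y * θ k) - x * θ k / (1 + x * θ k)) := by gcongr
    _ = _ := by ring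

theorem score_lt_score (hθ : ∀ k, θ k ∈ Set.Ioc (0 : ℝ) 1) {h : History N K t} {i : Fin N}
    (hD : 0 < exposure θ h i) {x y : ℝ} (hx : 0 ≤ x) (hxy : x < y) :
    score θ h i y < score θ h i x := by
  have := le_score_sub_score hθ h i hx hxy.le le_rfl
  have h2 : 0 < (y - x) * exposure θ h i / (1 + y) ^ 2 := by
    have : 0 < y - x := by linarith
    have : 0 < 1 + y := by linarith
    positivity
  linarith

theorem continuousOn_score (hθ : ∀ k, θ k ∈ Set.Ioc (0 : ℝ) 1) (h : History N K t) (i : Fin N) :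
    ContinuousOn (score θ h i) (Set.Ici 0) := by
  unfold score
  refine continuousOn_finsetSum _ fun k _ => ?_
  refine continuousOn_const.sub (continuousOn_const.mul (ContinuousOn.div (by fun_prop)
    (by fun_prop) fun x hx => ?_))
  have := mul_nonneg (Set.mem_Ici.1 hx) (hθ k).1.le
  positivity

theorem score_zero_nonneg (h : History N K t) (i : Fin N) : 0 ≤ score θ h i 0 := by
  simp only [score, zero_mul, zero_div, mul_zero, sub_zero]
  exact Finset.sum_nonneg fun _ _ => Nat.cast_nonneg _

/-- The clipped estimate either solves the score equation in `[0, 1]`, or equals `1` while the score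
is positive on `[0, 1]`. -/
theorem clippedMLE_spec (hθ : ∀ k, θ k ∈ Set.Ioc (0 : ℝ) 1) {h : History N K t} {i : Fin N}
    (hD : 0 < exposure θ h i) :
    (clippedMLE θ h i ∈ Set.Icc (0 : ℝ) 1 ∧ score θ h i (clippedMLE θ h i) = 0) ∨
      (clippedMLE θ h i = 1 ∧ 0 < score θ h i 1) := by
  rcases lt_or_ge 0 (score θ h i 1) with h1 | h1
  · right
    refine ⟨?_, h1⟩
    -- A root below `1` would contradict strict decrease; without roots the infimum is `∞`, so both
    -- cases clip to `1`.
    have : (1 : ℝ≥0∞) ≤ pairwiseMLE θ h i := by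
      refine le_iInf₂ fun x hx => ?_
      by_contra! hlt
      have hlt' : (x : ℝ) < 1 := by exact_mod_cast hlt
      have := score_lt_score hθ hD x.2 hlt'
      simp only [NNReal.val_eq_coe] at this
      linarith
    rw [clippedMLE, min_eq_right this, ENNReal.toReal_one]
  · left
    obtain ⟨x, hx, hx0⟩ := intermediate_value_Icc' (zero_le_one' ℝ)
      ((continuousOn_score hθ h i).mono Set.Icc_subset_Ici_self) ⟨h1, score_zero_nonneg h i⟩
    have hxe : pairwiseMLE θ h i = ENNReal.ofReal x := by
      refine le_antisymm (iInf₂_le (⟨x, hx.1⟩ : ℝ≥0) hx0 |>.trans_eq ?_) (le_iInf₂ fun y hy => ?_)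
      · rw [ENNReal.ofReal, Real.toNNReal_of_nonneg hx.1]
        rfl
      · have : x = y := by
          rcases lt_trichotomy x y with hlt | heq | hlt
          · have := score_lt_score hθ hD hx.1 hlt
            linarith
          · exact heq
          · have := score_lt_score hθ hD y.2 hlt
            simp only [NNReal.val_eq_coe] at this
            linarith
        simp [this]
    have hce : clippedMLE θ h i = x := by
      rw [clippedMLE, hxe, min_eq_left (ENNReal.ofReal_le_one.2 hx.2), ENNReal.toReal_ofReal hx.1]
    rw [hce]
    exact ⟨hx, hx0⟩

theorem clippedMLE_mem (θ : Fin K → ℝ) (h : History N K t) (i : Fin N) :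
    clippedMLE θ h i ∈ Set.Icc (0 : ℝ) 1 := by
  refine ⟨ENNReal.toReal_nonneg, ?_⟩
  exact (ENNReal.toReal_mono ENNReal.one_ne_top (min_le_right _ _)).trans_eq ENNReal.toReal_one

/-- Clipping is harmless: when it is active, the score at the estimate `1 ≥ v` is positive, which
only enlarges the score at `v`. -/
theorem abs_clippedMLE_sub_le (hθ : ∀ k, θ k ∈ Set.Ioc (0 : ℝ) 1) {h : History N K t} {i : Fin N}
    (hD : 0 < exposure θ h i) {v : ℝ} (hv : v ∈ Set.Icc (0 : ℝ) 1) :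
    |clippedMLE θ h i - v| * exposure θ h i / 4 ≤ |score θ h i v| := by
  have hm := clippedMLE_mem θ h i
  rcases le_total v (clippedMLE θ h i) with hle | hle
  · rw [abs_of_nonneg (by linarith)]
    have h1 := le_score_sub_score hθ h i hv.1 hle hm.2
    have h2 : 0 ≤ score θ h i (clippedMLE θ h i) := by
      rcases clippedMLE_spec hθ hD with ⟨_, he⟩ | ⟨he, hp⟩
      · exact he.ge
      · rw [he]; exact hp.le
    norm_num at h1
    linarith [le_abs_self (score θ h i v)]
  · rcases clippedMLE_spec hθ hD with ⟨_, he⟩ | ⟨he, _⟩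
    · rw [abs_of_nonpos (by linarith)]
      have h1 := le_score_sub_score hθ h i hm.1 hle hv.2
      norm_num at h1
      linarith [neg_abs_le (score θ h i v)]
    · have : clippedMLE θ h i = v := le_antisymm hle (he ▸ hv.2)
      simp [this]

end Score

/-! ### Deviation of the score at the true parameter -/

section Deviation

variable {N K : ℕ} {v : Fin N → ℝ} {θ : Fin K → ℝ}

/-- After division by `1 + a` the left side is the moment generating function of a centred Bernoulli
variable of mean `p`. It is bounded by `1 + x ≤ exp x`; then `p ≤ a` makes the compensator linear in
the exposure. -/
theorem bernoulli_mgf_le {l a : ℝ} (ha : 0 ≤ a) :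
    Real.exp (-l * (a / (1 + a))) + a * Real.exp (l * (1 - a / (1 + a)))
      ≤ (1 + a) * Real.exp ((Real.exp l - 1 - l) * a) := by
  set p := a / (1 + a) with hp
  have hpa : (1 + a) * p = a := by rw [hp]; field_simp
  have hp0 : 0 ≤ p := by positivity
  have hpl : p ≤ a := by nlinarith
  have hφ : 0 ≤ Real.exp l - 1 - l := by linarith [Real.add_one_le_exp l]
  have h1 : Real.exp (l * (1 - p)) = Real.exp (-l * p) * Real.exp l := by
    rw [← Real.exp_add]
    congr 1
    ring
  calc Real.exp (-l * p) + a * Real.exp (l * (1 - p))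
      = (1 + a) * (Real.exp (-l * p) * (p * (Real.exp l - 1) + 1)) := by
        rw [h1]
        linear_combination (Real.exp (-l * p) * (1 - Real.exp l)) * hpa
    _ ≤ (1 + a) * (Real.exp (-l * p) * Real.exp (p * (Real.exp l - 1))) := by
        gcongr
        exact Real.add_one_le_exp _
    _ = (1 + a) * Real.exp ((Real.exp l - 1 - l) * p) := by
        rw [← Real.exp_add]
        congr 2
        ring
    _ ≤ _ := by gcongr

/-- The exponential supermartingale of the score at the true parameter. -/
theorem histMean_exp_score_le_one (hv : ∀ i, 0 ≤ v i) (hθ : ∀ k, 0 ≤ θ k)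
    (hα : ∀ i k, 0 ≤ attraction v θ i k) (π : Policy N K) (i : Fin N) {l ψ : ℝ}
    (hψ : Real.exp l - 1 - l ≤ ψ) (t : ℕ) :
    histMean (attraction v θ) hα π t (fun h =>
      Real.exp (l * score θ h i (v i) - ψ * (v i * exposure θ h i))) ≤ 1 := by
  refine histMean_le_of_supermartingale (attraction v θ) hα π
    (fun t h => Real.exp (l * score θ h i (v i) - ψ * (v i * exposure θ h i))) 1
    (fun t h d => ?_) (fun h => ?_) t
  · have hV := totalAttraction_nonneg hα d
    by_cases hi : i ∈ d.1
    · rw [sum_choiceProb_mul_eq hα d i _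
        (Real.exp (l * score θ h i (v i) - ψ * (v i * exposure θ h i))) fun c hc hc' => by
          simp only [score, exposure, winCount_extend_of_ne h d hc,
            pairCount_extend_of_ne h d hc hc']]
      rw [score_extend_none θ h hi, score_extend_some θ h hi, exposure_extend θ h hi (.inl rfl),
        exposure_extend θ h hi (.inr rfl)]
      set ϑ := θ (d.2 ⟨i, hi⟩) with hϑ
      set A := l * score θ h i (v i) - ψ * (v i * exposure θ h i) with hA
      set a := v i * ϑ with ha
      have ha0 : 0 ≤ a := mul_nonneg (hv i) (hθ _)
      have e1 : l * (score θ h i (v i) - a / (1 + a)) - ψ * (v i * (exposure θ h i + ϑ))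
          = A + (-l * (a / (1 + a)) - ψ * a) := by rw [hA, ha]; ring
      have e2 : l * (score θ h i (v i) + (1 - a / (1 + a))) - ψ * (v i * (exposure θ h i + ϑ))
          = A + (l * (1 - a / (1 + a)) - ψ * a) := by rw [hA, ha]; ring
      have hP : choiceProb (attraction v θ) d (some i)
          = a / (1 + totalAttraction (attraction v θ) d) := by
        simp [choiceProb, hi, attraction, ha, hϑ]
      have key : Real.exp (-l * (a / (1 + a)) - ψ * a)
          + a * Real.exp (l * (1 - a / (1 + a)) - ψ * a) ≤ 1 + a := by
        have h1 := bernoulli_mgf_le (l := l) ha0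
        have h2 : (1 + a) * Real.exp ((Real.exp l - 1 - l) * a) ≤ (1 + a) * Real.exp (ψ * a) := by
          gcongr
        rw [Real.exp_sub, Real.exp_sub, ← mul_div_assoc a, ← add_div, div_le_iff₀ (Real.exp_pos _)]
        exact h1.trans h2
      rw [e1, e2, hP, Real.exp_add, Real.exp_add]
      simp only [choiceProb]
      have h3 : 0 ≤ Real.exp A / (1 + totalAttraction (attraction v θ) d) := by positivity
      have h4 := mul_le_mul_of_nonneg_left key h3
      -- The conditional drift is `exp A / (1 + V)` times the difference of the two sides of `key`,
      -- hence nonpositive.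
      rw [show ∀ x y z V : ℝ, x + 1 / V * (x * y - x) + a / V * (x * z - x)
        = x + (x / V * (y + a * z) - x / V * (1 + a)) from fun x y z V => by ring]
      linarith
    · simp only [score, exposure, winCount_extend_of_notMem h _ hi,
        pairCount_extend_of_notMem h _ hi]
      rw [← Finset.sum_mul, sum_choiceProb hα, one_mul]
  · simp [score, exposure, winCount, pairCount]

/-- The event that the score of product `i` deviates too far at the true parameter. -/
def scoreDeviates {t : ℕ} (v : Fin N → ℝ) (θ : Fin K → ℝ) (L : ℝ) (h : History N K t)
    (i : Fin N) : Prop :=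
  0 < exposure θ h i ∧ 2 * √(v i * exposure θ h i * L) + 2 / 3 * L < |score θ h i (v i)|

open Classical in
/-- Bernstein's inequality with the random variance proxy controlled by peeling. -/
theorem histMean_scoreDeviates_le [Nonempty (Fin K)] (hv : ∀ i, 0 < v i)
    (hθ : ∀ k, θ k ∈ Set.Ioc (0 : ℝ) 1) (hα : ∀ i k, 0 ≤ attraction v θ i k) (π : Policy N K)
    (i : Fin N) {L : ℝ} (hL : 0 < L) {t J : ℕ} (ht : (t : ℝ) ≤ thetaMin θ * 2 ^ J) :
    histMean (attraction v θ) hα π t (fun h => if scoreDeviates v θ L h i then 1 else 0)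
      ≤ 2 * (J + 1) * Real.exp (-L) := by
  have hm : 0 < thetaMin θ := thetaMin_pos fun k => (hθ k).1
  have hvi := hv i
  have hW : ∀ j : ℕ, 0 < v i * (thetaMin θ * 2 ^ (j + 1)) := fun j => by positivity
  -- One exponent per dyadic scale, tuned to the largest variance proxy on the scale where `D` lies
  -- between `θ_min 2^j` and `θ_min 2^(j+1)`.
  choose l hl0 hl using fun j : ℕ => exists_bernstein_exponent (hW j) hL
  let X : ℝ → ℕ → History N K t → ℝ := fun s j h =>
    Real.exp (s * l j * score θ h i (v i)
      - (Real.exp (l j) - 1 - l j) * (v i * exposure θ h i))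
  have hpt : ∀ h : History N K t, (if scoreDeviates v θ L h i then (1 : ℝ) else 0)
      ≤ ∑ j ∈ Finset.range (J + 1), Real.exp (-L) * (X 1 j h + X (-1) j h) := fun h => by
    have hnn : ∀ j ∈ Finset.range (J + 1), 0 ≤ Real.exp (-L) * (X 1 j h + X (-1) j h) :=
      fun j _ => by positivity
    split_ifs with hb
    swap
    · exact Finset.sum_nonneg hnn
    obtain ⟨hD, hdev⟩ := hb
    set D := exposure θ h i with hDdef
    have hn : 1 ≤ obsCount h i := by
      rw [Nat.one_le_iff_ne_zero]
      intro h0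
      have := exposure_le_obsCount (fun k => (hθ k).2) h i
      rw [h0, Nat.cast_zero] at this
      linarith
    have hDm : thetaMin θ ≤ D := by
      refine le_trans ?_ (thetaMin_mul_obsCount_le θ h i)
      exact le_mul_of_one_le_right hm.le (by exact_mod_cast hn)
    obtain ⟨j, hj1, hj2⟩ := exists_nat_pow_near (x := D / thetaMin θ) (y := (2 : ℝ))
      ((one_le_div hm).2 hDm) one_lt_two
    rw [le_div_iff₀ hm] at hj1
    rw [div_lt_iff₀ hm] at hj2
    have hjJ : j < J + 1 := by
      have h1 : D ≤ t := (exposure_le_obsCount (fun k => (hθ k).2) h i).trans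
        (by exact_mod_cast obsCount_le h i)
      have h2 : (2 : ℝ) ^ j ≤ 2 ^ J := by
        by_contra! hlt
        have := mul_lt_mul_of_pos_right hlt hm
        linarith
      have := (pow_le_pow_iff_right₀ (one_lt_two (α := ℝ))).1 h2
      omega
    refine le_trans ?_ (Finset.single_le_sum hnn (Finset.mem_range.2 hjJ))
    -- The scale's upper end is at most `2 D`, which turns the factor `√2` of Bernstein's bound into
    -- `2`.
    have hlarge : √(2 * (v i * (thetaMin θ * 2 ^ (j + 1))) * L) + L / 3
        ≤ |score θ h i (v i)| := by
      have : √(2 * (v i * (thetaMin θ * 2 ^ (j + 1))) * L) ≤ 2 * √(v i * D * L) := by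
        rw [show (2 : ℝ) * √(v i * D * L) = √(2 ^ 2 * (v i * D * L)) by
          rw [Real.sqrt_mul (x := 2 ^ 2) (by positivity), Real.sqrt_sq (by norm_num)]]
        refine Real.sqrt_le_sqrt ?_
        have h3 := mul_le_mul_of_nonneg_left hj1 (show 0 ≤ 4 * v i * L by positivity)
        rw [pow_succ]
        linarith
      linarith
    have hexp := hl j _ hlarge
    have hφ : 0 ≤ Real.exp (l j) - 1 - l j := by linarith [Real.add_one_le_exp (l j)]
    have hDle : (Real.exp (l j) - 1 - l j) * (v i * D)
        ≤ (Real.exp (l j) - 1 - l j) * (v i * (thetaMin θ * 2 ^ (j + 1))) := by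
      gcongr
      linarith
    have hX : Real.exp L ≤ X 1 j h + X (-1) j h := by
      rcases abs_cases (score θ h i (v i)) with ⟨hs, _⟩ | ⟨hs, _⟩ <;> rw [hs] at hexp
      · have : Real.exp L ≤ X 1 j h := Real.exp_le_exp.2 (by linarith)
        have : 0 ≤ X (-1) j h := (Real.exp_pos _).le
        linarith
      · have : Real.exp L ≤ X (-1) j h := Real.exp_le_exp.2 (by linarith)
        have : 0 ≤ X 1 j h := (Real.exp_pos _).le
        linarith
    calc (1 : ℝ) = Real.exp (-L) * Real.exp L := by rw [← Real.exp_add]; simp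
      _ ≤ _ := by gcongr
  refine (histMean_mono _ hα π hpt).trans ?_
  rw [histMean_sum]
  have hterm : ∀ j ∈ Finset.range (J + 1), histMean (attraction v θ) hα π t
      (fun h => Real.exp (-L) * (X 1 j h + X (-1) j h)) ≤ 2 * Real.exp (-L) := fun j _ => by
    rw [histMean_const_mul, histMean_add, mul_comm]
    refine mul_le_mul_of_nonneg_right ?_ (Real.exp_pos _).le
    -- By `l ≤ sinh l`, the compensator of the upper tail also serves the lower tail.
    have hψ : Real.exp (-1 * l j) - 1 - -1 * l j ≤ Real.exp (l j) - 1 - l j := by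
      have := Real.self_le_sinh_iff.2 (hl0 j)
      rw [Real.sinh_eq] at this
      rw [neg_one_mul]
      linarith
    have h1 := histMean_exp_score_le_one (fun i => (hv i).le) (fun k => (hθ k).1.le) hα π i
      (l := 1 * l j) (ψ := Real.exp (l j) - 1 - l j) (by rw [one_mul]) t
    have h2 := histMean_exp_score_le_one (fun i => (hv i).le) (fun k => (hθ k).1.le) hα π i hψ t
    linarith
  refine (Finset.sum_le_sum hterm).trans_eq ?_
  rw [Finset.sum_const, Finset.card_range, nsmul_eq_mul]
  push_cast
  ring

end Deviation

/-! ### From deviation around the truth to deviation around the estimate -/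

section ConfidenceBound

theorem C₃_eq : C₃ = C₁ ^ 2 / 4 + C₂ := by norm_num [C₁, C₂, C₃]

/-- A Bernstein-type deviation bound around the true value turns into one around the estimate. -/
theorem ucb_bounds {v w q : ℝ} (hv : 0 ≤ v) (hw : 0 ≤ w) (hq : 0 ≤ q)
    (hdev : |w - v| ≤ C₁ * (√v * √q) + C₂ * q) :
    v ≤ w + C₄ * √(w * q) + C₅ * q ∧
      w + C₄ * √(w * q) + C₅ * q ≤ v + C₆ * √(v * q) + C₇ * q := by
  have hC₁ : 0 ≤ C₁ := by norm_num [C₁]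
  have hC₂ : 0 ≤ C₂ := by norm_num [C₂]
  have hC₃ : 0 ≤ C₃ := by norm_num [C₃]
  rw [Real.sqrt_mul hw, Real.sqrt_mul hv]
  obtain ⟨h1, h2⟩ := abs_le.1 hdev
  set x := √v with hx
  set y := √w with hy
  set z := √q with hz
  have hx0 : 0 ≤ x := Real.sqrt_nonneg _
  have hy0 : 0 ≤ y := Real.sqrt_nonneg _
  have hz0 : 0 ≤ z := Real.sqrt_nonneg _
  have hxv : x ^ 2 = v := Real.sq_sqrt hv
  have hyw : y ^ 2 = w := Real.sq_sqrt hw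
  have hzq : z ^ 2 = q := Real.sq_sqrt hq
  have hc0 : 0 ≤ √C₂ := Real.sqrt_nonneg _
  have hc : √C₂ ^ 2 = C₂ := Real.sq_sqrt hC₂
  have hd0 : 0 ≤ √C₃ := Real.sqrt_nonneg _
  have hd : √C₃ ^ 2 = C₁ ^ 2 / 4 + C₂ := (Real.sq_sqrt hC₃).trans C₃_eq
  have he0 : 0 ≤ √(2 : ℝ) := Real.sqrt_nonneg _
  have he : √(2 : ℝ) ^ 2 = 2 := Real.sq_sqrt zero_le_two
  rw [← hxv, ← hyw, ← hzq] at h1 h2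
  rw [← hxv, ← hyw, ← hzq]
  constructor
  -- Solving `x² ≤ C₁ x z + C₂ z² + y²` for `x` and substituting into the linear term removes the
  -- unknown `x` from the width.
  · have hxle : x ≤ C₁ * z + (y + √C₂ * z) := by
      by_contra! hlt
      have h3 : (y + √C₂ * z) ^ 2 ≥ y ^ 2 + C₂ * z ^ 2 := by
        have : 0 ≤ y * (√C₂ * z) := by positivity
        nlinarith
      have h4 : 0 ≤ y + √C₂ * z := by positivity
      have h5 : 0 ≤ C₁ * z := by positivity
      nlinarith
    have h6 : x ^ 2 ≤ C₁ * (x * z) + C₂ * z ^ 2 + y ^ 2 := by linarith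
    have h7 : C₁ * (x * z) ≤ C₁ * ((C₁ * z + (y + √C₂ * z)) * z) := by gcongr
    have h8 : 0 ≤ C₁ * (y * z) := by positivity
    have h9 : 0 ≤ C₁ * √C₂ * z ^ 2 := by positivity
    simp only [C₄, C₅]
    nlinarith
  -- From `C₁ x z ≤ x² + C₁² z² / 4` follows `y² ≤ 2 x² + C₃ z²`; this is the origin of `C₃`.
  · have hyle : y ≤ √2 * x + √C₃ * z := by
      refine le_of_sq_le_sq ?_ (by positivity)
      have h3 : 0 ≤ √2 * x * (√C₃ * z) := by positivity
      have h4 : (√2 * x + √C₃ * z) ^ 2 = √2 ^ 2 * x ^ 2 + √C₃ ^ 2 * z ^ 2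
        + 2 * (√2 * x * (√C₃ * z)) := by ring
      rw [h4, he, hd]
      nlinarith [sq_nonneg (x - C₁ * z / 2)]
    have h5 : C₄ * (y * z) ≤ C₄ * ((√2 * x + √C₃ * z) * z) := by
      have : 0 ≤ C₄ := by norm_num [C₄, C₁]
      gcongr
    simp only [C₆, C₇]
    nlinarith

end ConfidenceBound

/-! ### Optimism and sensitivity of the revenue -/

section Revenue

variable {N K : ℕ} {v u r : Fin N → ℝ} {θ : Fin K → ℝ}

/-- The position effect at which `i` is displayed, and `0` if `i` is not displayed. -/
def displayEffect (θ : Fin K → ℝ) (d : Decision N K) (i : Fin N) : ℝ :=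
  if hi : i ∈ d.1 then θ (d.2 ⟨i, hi⟩) else 0

theorem displayEffect_nonneg (hθ : ∀ k, 0 ≤ θ k) (d : Decision N K) (i : Fin N) :
    0 ≤ displayEffect θ d i := by
  unfold displayEffect
  split_ifs
  · exact hθ _
  · exact le_rfl

theorem totalAttraction_attraction (v : Fin N → ℝ) (θ : Fin K → ℝ) (d : Decision N K) :
    totalAttraction (attraction v θ) d = ∑ i, v i * displayEffect θ d i := by
  rw [← Finset.sum_subset (Finset.subset_univ d.1)
    (fun i _ hi => by simp [displayEffect, hi]), ← Finset.sum_coe_sort d.1, totalAttraction]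
  exact Finset.sum_congr rfl fun i _ => by simp [displayEffect, attraction]

theorem revenue_attraction (r v : Fin N → ℝ) (θ : Fin K → ℝ) (d : Decision N K) :
    revenue r (attraction v θ) d = (∑ i, r i * (v i * displayEffect θ d i))
      / (1 + ∑ i, v i * displayEffect θ d i) := by
  rw [revenue, Finset.sum_div, ← totalAttraction_attraction,
    ← Finset.sum_subset (Finset.subset_univ d.1)
    (fun i _ hi => by simp [displayEffect, hi])]
  refine Finset.sum_congr rfl fun i hi => ?_
  simp [choiceProb, hi, displayEffect, attraction, mul_div_assoc]

theorem sum_mul_displayEffect_nonneg (hv : ∀ i, 0 ≤ v i) (hθ : ∀ k, 0 ≤ θ k)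
    (d : Decision N K) : 0 ≤ ∑ i, v i * displayEffect θ d i :=
  Finset.sum_nonneg fun i _ => mul_nonneg (hv i) (displayEffect_nonneg hθ d i)

/-- Clearing the denominator makes the level condition linear in `v`, with coefficients whose signs
are those of `r i - R`. -/
theorem le_revenue_iff (hv : ∀ i, 0 ≤ v i) (hθ : ∀ k, 0 ≤ θ k) (d : Decision N K) (R : ℝ) :
    R ≤ revenue r (attraction v θ) d ↔ R ≤ ∑ i, (r i - R) * (v i * displayEffect θ d i) := by
  have hV := sum_mul_displayEffect_nonneg hv hθ d
  rw [revenue_attraction, le_div_iff₀ (by linarith)]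
  simp only [sub_mul, Finset.sum_sub_distrib, ← Finset.mul_sum]
  constructor <;> intro h <;> linarith

/-- Optimism: raising the attractions cannot lower the best attainable revenue. -/
theorem exists_revenue_le (hv : ∀ i, 0 ≤ v i) (huv : ∀ i, v i ≤ u i) (hθ : ∀ k, 0 ≤ θ k)
    (d : Decision N K) :
    ∃ d', revenue r (attraction v θ) d ≤ revenue r (attraction u θ) d' := by
  set R := revenue r (attraction v θ) d with hR
  classical
  -- Dropping the products with `r i < R` removes nonpositive terms; what remains is nondecreasing
  -- in the attractions.
  let d' : Decision N K := ⟨d.1.filter fun i => R ≤ r i,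
    ⟨fun x => d.2 ⟨x.1, (Finset.mem_filter.1 x.2).1⟩, fun x y hxy => by
      exact Subtype.ext (congrArg (fun z : d.1 => (z : Fin N)) (d.2.injective hxy))⟩⟩
  have hd' : ∀ i, displayEffect θ d' i = if R ≤ r i then displayEffect θ d i else 0 := fun i => by
    by_cases h1 : i ∈ d.1 <;> by_cases h2 : R ≤ r i <;> simp [displayEffect, d', h1, h2]
    rfl
  refine ⟨d', (le_revenue_iff (fun i => (hv i).trans (huv i)) hθ d' R).2 ?_⟩
  refine ((le_revenue_iff hv hθ d R).1 hR.le).trans (Finset.sum_le_sum fun i _ => ?_)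
  have hp := displayEffect_nonneg hθ d i
  rw [hd' i]
  split_ifs with h
  · have : 0 ≤ r i - R := by linarith
    have := huv i
    gcongr
  · rw [mul_zero, mul_zero]
    exact mul_nonpos_of_nonpos_of_nonneg (by linarith) (mul_nonneg (hv i) hp)

/-- Replacing the denominator under `u` by the smaller one under `v` only raises the first revenue;
the numerators then differ by at most the weighted `u - v`, as `r ≤ 1`. -/
theorem revenue_sub_revenue_le (hv : ∀ i, 0 ≤ v i) (huv : ∀ i, v i ≤ u i) (hθ : ∀ k, 0 ≤ θ k)
    (hr : ∀ i, r i ∈ Set.Icc (0 : ℝ) 1) (d : Decision N K) :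
    revenue r (attraction u θ) d - revenue r (attraction v θ) d ≤
      ∑ i, displayEffect θ d i / (1 + totalAttraction (attraction v θ) d) * (u i - v i) := by
  have hV := sum_mul_displayEffect_nonneg hv hθ d
  have hp := displayEffect_nonneg hθ d
  rw [revenue_attraction, revenue_attraction, totalAttraction_attraction]
  have h1 : (∑ i, r i * (u i * displayEffect θ d i)) / (1 + ∑ i, u i * displayEffect θ d i)
      ≤ (∑ i, r i * (u i * displayEffect θ d i)) / (1 + ∑ i, v i * displayEffect θ d i) := by
    refine div_le_div_of_nonneg_left (Finset.sum_nonneg fun i _ => mul_nonneg (hr i).1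
      (mul_nonneg ((hv i).trans (huv i)) (hp i))) (by linarith) ?_
    gcongr with i
    · exact hp i
    · exact huv i
  refine (sub_le_sub_right h1 _).trans ?_
  rw [← sub_div, ← Finset.sum_sub_distrib, Finset.sum_div]
  refine Finset.sum_le_sum fun i _ => ?_
  rw [div_mul_eq_mul_div]
  gcongr
  have : 0 ≤ displayEffect θ d i * (u i - v i) := mul_nonneg (hp i) (by linarith [huv i])
  nlinarith [mul_le_of_le_one_left this (hr i).2]

theorem revenue_mem {α : Fin N → Fin K → ℝ} (hα : ∀ i k, 0 ≤ α i k)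
    (hr : ∀ i, r i ∈ Set.Icc (0 : ℝ) 1) (d : Decision N K) :
    revenue r α d ∈ Set.Icc (0 : ℝ) 1 := by
  constructor
  · exact Finset.sum_nonneg fun i _ => mul_nonneg (hr i).1 (choiceProb_nonneg hα d _)
  · have h1 := sum_choiceProb hα d
    rw [Fintype.sum_option] at h1
    have h2 := choiceProb_nonneg hα d none
    have h3 : revenue r α d ≤ ∑ i ∈ d.1, choiceProb α d (some i) :=
      Finset.sum_le_sum fun i _ => mul_le_of_le_one_left (choiceProb_nonneg hα d _) (hr i).2
    have h4 : ∑ i ∈ d.1, choiceProb α d (some i) ≤ ∑ i, choiceProb α d (some i) :=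
      Finset.sum_le_univ_sum_of_nonneg fun i => choiceProb_nonneg hα d _
    linarith

theorem optRevenue_sub_revenue_le_one {α : Fin N → Fin K → ℝ} (hα : ∀ i k, 0 ≤ α i k)
    (hr : ∀ i, r i ∈ Set.Icc (0 : ℝ) 1) (d : Decision N K) :
    optRevenue r α - revenue r α d ≤ 1 := by
  have h1 : optRevenue r α ≤ 1 := ciSup_le fun d => (revenue_mem hα hr d).2
  linarith [(revenue_mem hα hr d).1]

/-- The loss of an optimistic decision is at most the weighted overestimation. -/
theorem optRevenue_sub_revenue_le (hv : ∀ i, 0 ≤ v i) (huv : ∀ i, v i ≤ u i)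
    (hθ : ∀ k, 0 ≤ θ k) (hr : ∀ i, r i ∈ Set.Icc (0 : ℝ) 1) {d : Decision N K}
    (hd : ∀ d', revenue r (attraction u θ) d' ≤ revenue r (attraction u θ) d) :
    optRevenue r (attraction v θ) - revenue r (attraction v θ) d ≤
      ∑ i, displayEffect θ d i / (1 + totalAttraction (attraction v θ) d) * (u i - v i) := by
  obtain ⟨d₀, h₀⟩ := exists_eq_ciSup_of_finite (f := fun d => revenue r (attraction v θ) d)
  obtain ⟨d₁, h₁⟩ := exists_revenue_le (r := r) hv huv hθ d₀
  have h2 : optRevenue r (attraction v θ) ≤ revenue r (attraction u θ) d := by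
    rw [optRevenue, ← h₀]
    exact h₁.trans (hd d₁)
  linarith [revenue_sub_revenue_le hv huv hθ hr d]

end Revenue

/-! ### Exploration cost by telescoping potentials -/

section Exploration

variable {N K : ℕ} {v : Fin N → ℝ} {θ : Fin K → ℝ}

/-- The weight with which an overestimation of `v i` enters the loss of the decision `d`. -/
def lossWeight (v : Fin N → ℝ) (θ : Fin K → ℝ) (d : Decision N K) (i : Fin N) : ℝ :=
  displayEffect θ d i / (1 + totalAttraction (attraction v θ) d)

theorem lossWeight_nonneg (hθ : ∀ k, 0 ≤ θ k) (hα : ∀ i k, 0 ≤ attraction v θ i k)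
    (d : Decision N K) (i : Fin N) : 0 ≤ lossWeight v θ d i := by
  have := totalAttraction_nonneg hα d
  have := displayEffect_nonneg hθ d i
  unfold lossWeight
  positivity

/-- The sum is the probability `V / (1 + V)` of a purchase. -/
theorem sum_lossWeight_mul_le_one (hα : ∀ i k, 0 ≤ attraction v θ i k) (d : Decision N K) :
    ∑ i, lossWeight v θ d i * v i ≤ 1 := by
  have hV := totalAttraction_nonneg hα d
  have : ∑ i, lossWeight v θ d i * v i
      = totalAttraction (attraction v θ) d / (1 + totalAttraction (attraction v θ) d) := by
    conv_rhs => rw [totalAttraction_attraction v θ d, Finset.sum_div,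
      ← totalAttraction_attraction v θ d]
    refine Finset.sum_congr rfl fun i _ => ?_
    rw [lossWeight, div_mul_eq_mul_div, mul_comm]
  rw [this, div_le_one (by linarith)]
  linarith

/-- Each unit of loss weight is paid for by the probability of a relevant observation. -/
theorem sum_roundMean_lossWeight_le (hθ : ∀ k, θ k ∈ Set.Ioc (0 : ℝ) 1)
    (hα : ∀ i k, 0 ≤ attraction v θ i k) (π : Policy N K) (i : Fin N) {F : ℕ → ℝ}
    (hF : Monotone F) (hF0 : 0 ≤ F 0) (T : ℕ) :
    ∑ t ∈ Finset.range T, roundMean (attraction v θ) hα π t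
      (fun h d => lossWeight v θ d i * (F (obsCount h i + 1) - F (obsCount h i))) ≤ F T := by
  refine (sum_roundMean_le_of_potential (attraction v θ) hα π
    (fun t h => F (obsCount h i)) _ (fun t h d => ?_) (fun h => ?_) T).trans ?_
  · have hV := totalAttraction_nonneg hα d
    have hinc : 0 ≤ F (obsCount h i + 1) - F (obsCount h i) := sub_nonneg.2 (hF (Nat.le_succ _))
    by_cases hi : i ∈ d.1
    · rw [sum_choiceProb_mul_eq hα d i _ (F (obsCount h i)) fun c hc hc' => by
        simp only [obsCount, pairCount_extend_of_ne h d hc hc']]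
      rw [obsCount_extend h hi (.inl rfl), obsCount_extend h hi (.inr rfl), add_assoc, ← add_mul]
      gcongr
      -- The outside option alone pays for the weight, because `θ ≤ 1`.
      have h1 : lossWeight v θ d i ≤ choiceProb (attraction v θ) d none := by
        simp only [lossWeight, displayEffect, hi, dite_true, choiceProb]
        gcongr
        exact (hθ _).2
      have h2 := choiceProb_nonneg hα d (some i)
      linarith
    · simp only [obsCount, pairCount_extend_of_notMem h _ hi]
      rw [← Finset.sum_mul, sum_choiceProb hα]
      simp [lossWeight, displayEffect, hi]
  · exact hF0.trans (hF (Nat.zero_le _))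
  · exact (histMean_mono _ hα π fun h => hF (obsCount_le h i)).trans_eq (histMean_const _ hα π T _)

/-- The term `m = 0` vanishes by `0⁻¹ = 0`, which leaves a harmonic number. -/
theorem sum_range_inv_le {T : ℕ} (hT : 1 ≤ T) :
    ∑ m ∈ Finset.range T, ((m : ℝ))⁻¹ ≤ 1 + Real.log T := by
  obtain ⟨n, rfl⟩ : ∃ n, T = n + 1 := ⟨T - 1, by omega⟩
  rw [Finset.sum_range_succ']
  have h1 := harmonic_le_one_add_log n
  rw [harmonic] at h1
  push_cast at h1 ⊢
  rw [inv_zero, add_zero]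
  refine h1.trans ?_
  rcases n.eq_zero_or_pos with rfl | hn
  · simp
  · have : (0 : ℝ) < n := by exact_mod_cast hn
    gcongr
    linarith

theorem sum_roundMean_unexplored_le (hθ : ∀ k, θ k ∈ Set.Ioc (0 : ℝ) 1)
    (hα : ∀ i k, 0 ≤ attraction v θ i k) (π : Policy N K) (i : Fin N) (T : ℕ) :
    ∑ t ∈ Finset.range T, roundMean (attraction v θ) hα π t
      (fun h d => lossWeight v θ d i * if obsCount h i = 0 then 1 else 0) ≤ 1 := by
  have hF : Monotone fun n : ℕ => if n = 0 then (0 : ℝ) else 1 := fun a b hab => by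
    by_cases ha : a = 0 <;> by_cases hb : b = 0 <;> simp [ha, hb]
    omega
  refine le_trans (le_of_eq ?_) ((sum_roundMean_lossWeight_le hθ hα π i hF (by simp) T).trans ?_)
  · refine Finset.sum_congr rfl fun t _ => ?_
    congr 1
    funext h d
    by_cases h0 : obsCount h i = 0 <;> simp [h0]
  · split_ifs <;> norm_num

theorem sum_roundMean_inv_obsCount_le (hθ : ∀ k, θ k ∈ Set.Ioc (0 : ℝ) 1)
    (hα : ∀ i k, 0 ≤ attraction v θ i k) (π : Policy N K) (i : Fin N) {T : ℕ} (hT : 1 ≤ T) :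
    ∑ t ∈ Finset.range T, roundMean (attraction v θ) hα π t
      (fun h d => lossWeight v θ d i * (obsCount h i : ℝ)⁻¹) ≤ 1 + Real.log T := by
  have hF : Monotone fun n : ℕ => ∑ m ∈ Finset.range n, ((m : ℝ))⁻¹ :=
    monotone_nat_of_le_succ fun n => by
      rw [Finset.sum_range_succ]
      have : (0 : ℝ) ≤ (n : ℝ)⁻¹ := by positivity
      linarith
  refine le_trans (le_of_eq ?_) ((sum_roundMean_lossWeight_le hθ hα π i hF (by simp) T).trans
    (sum_range_inv_le hT))
  refine Finset.sum_congr rfl fun t _ => ?_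
  congr 1
  funext h d
  simp [Finset.sum_range_succ]

end Exploration

/-! ### Width of the confidence bounds in terms of observation counts -/

section Confidence

variable {N K t : ℕ} {v : Fin N → ℝ} {θ : Fin K → ℝ}

/-- Exposure and observation count vanish together. Before the first observation the width terms are
`0` by `0⁻¹ = 0`, and the indicator pays for the default value `1`; afterwards `D ≥ θ_min n`. -/
theorem ucb_bounds_of_not_scoreDeviates [Nonempty (Fin K)] (hv : ∀ i, v i ∈ Set.Ioc (0 : ℝ) 1)
    (hθ : ∀ k, θ k ∈ Set.Ioc (0 : ℝ) 1) {T : ℕ} {L : ℝ} (hL : 0 ≤ L)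
    (hLdef : Real.log (peelConst T θ / confidence N T) = L) {h : History N K t} {i : Fin N}
    (hdev : ¬ scoreDeviates v θ L h i) :
    v i ≤ ucb T θ h i ∧ ucb T θ h i - v i ≤ (if obsCount h i = 0 then 1 else 0)
      + C₆ * √(v i * (L / thetaMin θ * (obsCount h i : ℝ)⁻¹))
      + C₇ * (L / thetaMin θ * (obsCount h i : ℝ)⁻¹) := by
  have hm : 0 < thetaMin θ := thetaMin_pos fun k => (hθ k).1
  have hvi := hv i
  have hC₆ : 0 ≤ C₆ := by
    unfold C₆ C₄ C₁
    positivity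
  have hC₇ : 0 ≤ C₇ := by
    unfold C₇ C₅ C₄ C₁ C₂
    positivity
  rw [ucb, hLdef]
  split_ifs with hD h0
  · have := exposure_le_obsCount (fun k => (hθ k).2) h i
    rw [h0, Nat.cast_zero] at this
    linarith
  · set D := exposure θ h i with hDdef
    have hS : |score θ h i (v i)| ≤ 2 * √(v i * D * L) + 2 / 3 * L := by
      by_contra! hlt
      exact hdev ⟨hD, hlt⟩
    have hq : 0 ≤ L / D := by positivity
    have h1 := (abs_clippedMLE_sub_le hθ hD ⟨hvi.1.le, hvi.2⟩).trans hS
    have h2 : √(v i * D * L) = √(v i) * √(L / D) * D := by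
      have h4 : v i * D * L = v i * (L / D) * D ^ 2 := by field_simp
      rw [h4, Real.sqrt_mul (mul_nonneg hvi.1.le hq), Real.sqrt_mul hvi.1.le, Real.sqrt_sq hD.le]
    -- `C₁ = 4 * 2` and `C₂ = 4 * (2 / 3)`: the inverse slope `4 / D` times the two deviation
    -- coefficients.
    have h3 : |clippedMLE θ h i - v i| ≤ C₁ * (√(v i) * √(L / D)) + C₂ * (L / D) := by
      rw [h2] at h1
      have h4 : L = L / D * D := by field_simp
      have h5 : |clippedMLE θ h i - v i| * D
          ≤ (8 * (√(v i) * √(L / D)) + 8 / 3 * (L / D)) * D := by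
        rw [add_mul, mul_assoc (8 / 3), ← h4]
        linarith
      exact le_of_mul_le_mul_right h5 hD
    obtain ⟨h6, h7⟩ := ucb_bounds hvi.1.le (clippedMLE_mem θ h i).1 hq h3
    rw [mul_div_assoc]
    refine ⟨h6, ?_⟩
    have hn : (0 : ℝ) < obsCount h i := by exact_mod_cast Nat.pos_of_ne_zero h0
    have h8 : L / D ≤ L / thetaMin θ * (obsCount h i : ℝ)⁻¹ := by
      rw [← div_eq_mul_inv, div_div]
      exact div_le_div_of_nonneg_left hL (by positivity) (thetaMin_mul_obsCount_le θ h i)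
    have h9 : C₆ * √(v i * (L / D))
        ≤ C₆ * √(v i * (L / thetaMin θ * (obsCount h i : ℝ)⁻¹)) := by
      have := hvi.1.le
      gcongr
    have h10 : C₇ * (L / D) ≤ C₇ * (L / thetaMin θ * (obsCount h i : ℝ)⁻¹) := by gcongr
    linarith
  · refine ⟨hvi.2, ?_⟩
    have : 0 ≤ C₆ * √(v i * (L / thetaMin θ * (obsCount h i : ℝ)⁻¹)) := by positivity
    have : 0 ≤ C₇ * (L / thetaMin θ * (obsCount h i : ℝ)⁻¹) := by positivity
    linarith [hvi.1]
  · rename_i h0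
    exfalso
    have hn : (1 : ℝ) ≤ obsCount h i := by exact_mod_cast Nat.one_le_iff_ne_zero.2 h0
    have := thetaMin_mul_obsCount_le θ h i
    nlinarith

/-- AM-GM with a free weight `η` stands in for Cauchy–Schwarz over rounds and products: it is linear
in `x` and `y`, which are summed by different bounds. -/
theorem sqrt_mul_mul_inv_le {x B y η : ℝ} (hx : 0 ≤ x) (hB : 0 ≤ B) (hy : 0 ≤ y) (hη : 0 < η) :
    √(x * (B * y)) ≤ √B * ((η * x + η⁻¹ * y) / 2) := by
  rw [mul_left_comm, Real.sqrt_mul hB]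
  refine mul_le_mul_of_nonneg_left ?_ (Real.sqrt_nonneg B)
  refine Real.sqrt_le_iff.2 ⟨by positivity, ?_⟩
  have h := sq_nonneg (η * x - η⁻¹ * y)
  have h2 : η * η⁻¹ = 1 := mul_inv_cancel₀ hη.ne'
  have h3 : (η * x) * (η⁻¹ * y) = x * y := by
    rw [mul_mul_mul_comm, h2, one_mul]
  nlinarith

end Confidence

/-! ### Regret decomposition -/

section Regret

variable {N K T : ℕ}

open Classical in
/-- Loss of one round, split into failure of the confidence bounds, first exploration, and the
width of the confidence bounds. -/
theorem optRevenue_sub_revenue_le_of_policy [Nonempty (Fin K)] (M : Model N K) {π : Policy N K}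
    (hπ : IsP2MLEUCB T M.θ M.r π) {L : ℝ} (hL : 0 ≤ L)
    (hLdef : Real.log (peelConst T M.θ / confidence N T) = L) {η : ℝ} (hη : 0 < η) {t : ℕ}
    (ht : t < T) (h : History N K t) {d : Decision N K} (hd : d ∈ (π t h).support) :
    optRevenue M.r M.α - revenue M.r M.α d ≤
      ∑ i, (if scoreDeviates M.v M.θ L h i then 1 else 0)
      + ∑ i, lossWeight M.v M.θ d i * (if obsCount h i = 0 then 1 else 0)
      + C₆ * √(L / thetaMin M.θ) * η / 2
      + (C₆ * √(L / thetaMin M.θ) * η⁻¹ / 2 + C₇ * (L / thetaMin M.θ))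
        * ∑ i, lossWeight M.v M.θ d i * (obsCount h i : ℝ)⁻¹ := by
  have hm : 0 < thetaMin M.θ := thetaMin_pos fun k => (M.θ_mem k).1
  have hC₆ : 0 ≤ C₆ := by
    unfold C₆ C₄ C₁
    positivity
  have hC₇ : 0 ≤ C₇ := by
    unfold C₇ C₅ C₄ C₁ C₂
    positivity
  have hw := lossWeight_nonneg (fun k => (M.θ_mem k).1.le) M.α_nonneg d
  have hdev : ∀ i, (0 : ℝ) ≤ if scoreDeviates M.v M.θ L h i then 1 else 0 := fun i => by
    split_ifs <;> norm_num
  have hdev' : (0 : ℝ) ≤ ∑ i, if scoreDeviates M.v M.θ L h i then 1 else 0 :=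
    Finset.sum_nonneg fun i _ => hdev i
  have hfirst : 0 ≤ ∑ i, lossWeight M.v M.θ d i * (if obsCount h i = 0 then (1 : ℝ) else 0) :=
    Finset.sum_nonneg fun i _ => mul_nonneg (hw i) (by split_ifs <;> norm_num)
  have hinv : 0 ≤ ∑ i, lossWeight M.v M.θ d i * (obsCount h i : ℝ)⁻¹ :=
    Finset.sum_nonneg fun i _ => mul_nonneg (hw i) (by positivity)
  -- If one bound fails, its indicator already pays for a loss of at most `1`.
  by_cases hbad : ∃ i, scoreDeviates M.v M.θ L h i
  · obtain ⟨i, hi⟩ := hbad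
    have h1 := Finset.single_le_sum (fun j _ => hdev j) (Finset.mem_univ i)
    rw [if_pos hi] at h1
    have h2 := optRevenue_sub_revenue_le_one M.α_nonneg M.r_mem d
    have : 0 ≤ C₆ * √(L / thetaMin M.θ) * η / 2 := by positivity
    have : 0 ≤ (C₆ * √(L / thetaMin M.θ) * η⁻¹ / 2 + C₇ * (L / thetaMin M.θ))
        * ∑ i, lossWeight M.v M.θ d i * (obsCount h i : ℝ)⁻¹ := by positivity
    linarith
  · push Not at hbad
    have hucb := fun i => ucb_bounds_of_not_scoreDeviates M.v_mem M.θ_mem hL hLdef (hbad i)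
    have h1 := optRevenue_sub_revenue_le (fun i => (M.v_mem i).1.le) (fun i => (hucb i).1)
      (fun k => (M.θ_mem k).1.le) M.r_mem (hπ t ht h d hd)
    have h2 : ∀ i, displayEffect M.θ d i / (1 + totalAttraction (attraction M.v M.θ) d)
        * (ucb T M.θ h i - M.v i) ≤
        lossWeight M.v M.θ d i * (if obsCount h i = 0 then 1 else 0)
        + C₆ * √(L / thetaMin M.θ) * η / 2 * (lossWeight M.v M.θ d i * M.v i)
        + (C₆ * √(L / thetaMin M.θ) * η⁻¹ / 2 + C₇ * (L / thetaMin M.θ))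
          * (lossWeight M.v M.θ d i * (obsCount h i : ℝ)⁻¹) := fun i => by
      have h3 := sqrt_mul_mul_inv_le (M.v_mem i).1.le (B := L / thetaMin M.θ) (by positivity)
        (y := (obsCount h i : ℝ)⁻¹) (by positivity) hη
      have h4 := (hucb i).2.trans (add_le_add_left (add_le_add_right
        (mul_le_mul_of_nonneg_left h3 hC₆) _) _)
      refine (mul_le_mul_of_nonneg_left h4 (hw i)).trans_eq ?_
      ring
    have h5 := h1.trans (Finset.sum_le_sum fun i _ => h2 i)
    rw [Finset.sum_add_distrib, Finset.sum_add_distrib, ← Finset.mul_sum, ← Finset.mul_sum] at h5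
    have h6 : C₆ * √(L / thetaMin M.θ) * η / 2 * ∑ i, lossWeight M.v M.θ d i * M.v i
        ≤ C₆ * √(L / thetaMin M.θ) * η / 2 :=
      mul_le_of_le_one_right (by positivity) (sum_lossWeight_mul_le_one M.α_nonneg d)
    change optRevenue M.r (attraction M.v M.θ) - revenue M.r (attraction M.v M.θ) d ≤ _
    linarith

theorem regret_le_horizon (M : Model N K) (π : Policy N K) (T : ℕ) :
    regret M.r M.α M.α_nonneg T π ≤ T := by
  rw [regret_eq_sum_roundMean]
  have h : ∀ t ∈ Finset.range T, roundMean M.α M.α_nonneg π t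
      (fun _ d => optRevenue M.r M.α - revenue M.r M.α d) ≤ 1 := fun t _ =>
    (roundMean_mono _ _ _ fun _ d _ => optRevenue_sub_revenue_le_one M.α_nonneg M.r_mem d).trans_eq
      (roundMean_const _ _ _ t 1)
  simpa using Finset.sum_le_sum h

theorem regret_le_of_deviation [Nonempty (Fin K)] (hT : 1 ≤ T) (M : Model N K)
    {π : Policy N K} (hπ : IsP2MLEUCB T M.θ M.r π) {L : ℝ} (hL : 0 < L)
    (hLdef : Real.log (peelConst T M.θ / confidence N T) = L) {η : ℝ} (hη : 0 < η) {J : ℕ}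
    (hJ : (T : ℝ) ≤ thetaMin M.θ * 2 ^ J) :
    regret M.r M.α M.α_nonneg T π ≤ T * (N * (2 * (J + 1) * Real.exp (-L))) + N
      + C₆ * √(L / thetaMin M.θ) * η / 2 * T
      + (C₆ * √(L / thetaMin M.θ) * η⁻¹ / 2 + C₇ * (L / thetaMin M.θ))
        * (N * (1 + Real.log T)) := by
  classical
  have hm : 0 < thetaMin M.θ := thetaMin_pos fun k => (M.θ_mem k).1
  have hC₆ : 0 ≤ C₆ := by
    unfold C₆ C₄ C₁
    positivity
  have hC₇ : 0 ≤ C₇ := by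
    unfold C₇ C₅ C₄ C₁ C₂
    positivity
  rw [regret_eq_sum_roundMean]
  refine (Finset.sum_le_sum fun t ht => roundMean_mono _ _ _ fun h d hd =>
    optRevenue_sub_revenue_le_of_policy M hπ hL.le hLdef hη (Finset.mem_range.1 ht) h hd).trans ?_
  simp only [roundMean_add, roundMean_const_mul, roundMean_sum, roundMean_const,
    Finset.sum_add_distrib, roundMean_of_history, ← Finset.mul_sum]
  refine add_le_add (add_le_add (add_le_add ?_ ?_) ?_) (mul_le_mul_of_nonneg_left ?_ (by positivity))
  · have : ∀ t ∈ Finset.range T, ∑ i, histMean M.α M.α_nonneg π t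
        (fun h => if scoreDeviates M.v M.θ L h i then (1 : ℝ) else 0)
        ≤ N * (2 * (J + 1) * Real.exp (-L)) := fun t ht => by
      have h1 : (t : ℝ) ≤ T := by exact_mod_cast (Finset.mem_range.1 ht).le
      exact (Finset.sum_le_sum fun i _ => histMean_scoreDeviates_le (fun i => (M.v_mem i).1)
        M.θ_mem M.α_nonneg π i hL (h1.trans hJ)).trans_eq (by simp)
    simpa using Finset.sum_le_sum this
  · rw [Finset.sum_comm]
    exact (Finset.sum_le_sum fun i _ =>
      sum_roundMean_unexplored_le M.θ_mem M.α_nonneg π i T).trans_eq (by simp)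
  · simp [mul_comm]
  · rw [Finset.sum_comm]
    exact (Finset.sum_le_sum fun i _ =>
      sum_roundMean_inv_obsCount_le M.θ_mem M.α_nonneg π i hT).trans_eq (by simp [mul_add])

end Regret

/-! ### The peeling constant and the logarithmic factor -/

section Horizon

variable {N K T : ℕ} {θ : Fin K → ℝ}

theorem thetaMin_le_one [Nonempty (Fin K)] (hθ : ∀ k, θ k ≤ 1) : thetaMin θ ≤ 1 :=
  (thetaMin_le θ (Classical.arbitrary _)).trans (hθ _)

/-- The peeling constant counts twice the dyadic scales between `θ_min` and `T`. -/
theorem exists_peelConst_eq [Nonempty (Fin K)] (hθ : ∀ k, θ k ∈ Set.Ioc (0 : ℝ) 1) (hT : 1 ≤ T) :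
    ∃ J : ℕ, peelConst T θ = 2 * ((J : ℝ) + 1) ∧ (T : ℝ) ≤ thetaMin θ * 2 ^ J := by
  have hm : 0 < thetaMin θ := thetaMin_pos fun k => (hθ k).1
  have hT' : (1 : ℝ) ≤ T := by exact_mod_cast hT
  have h1 : 1 ≤ T / thetaMin θ := by
    rw [one_le_div hm]
    exact (thetaMin_le_one fun k => (hθ k).2).trans hT'
  have hnn : 0 ≤ ⌈Real.logb 2 (T / thetaMin θ)⌉ :=
    Int.ceil_nonneg (Real.logb_nonneg one_lt_two h1)
  obtain ⟨J, hJ⟩ := Int.eq_ofNat_of_zero_le hnn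
  refine ⟨J, by rw [peelConst, hJ]; norm_cast, ?_⟩
  have h2 := Int.le_ceil (Real.logb 2 (T / thetaMin θ))
  rw [hJ, Real.logb_le_iff_le_rpow one_lt_two (by linarith)] at h2
  rw [← div_le_iff₀' hm]
  exact_mod_cast h2

theorem peelConst_div_confidence (N T : ℕ) (θ : Fin K → ℝ) :
    peelConst T θ / confidence N T = 3 * peelConst T θ * N * T / 2 := by
  rw [confidence, div_div_eq_mul_div]
  ring

/-- The argument is at least `3 > e`. This gives `L / θ_min ≥ 1`, which lets `C̃ √(N T)` absorb the
trivial bound on short horizons. -/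
theorem one_le_log_peelConst [Nonempty (Fin K)] (hθ : ∀ k, θ k ∈ Set.Ioc (0 : ℝ) 1)
    (hN : 1 ≤ N) (hT : 1 ≤ T) : 1 ≤ Real.log (3 * peelConst T θ * N * T / 2) := by
  obtain ⟨J, hJ, _⟩ := exists_peelConst_eq hθ hT
  have hT' : (1 : ℝ) ≤ T := by exact_mod_cast hT
  have hN' : (1 : ℝ) ≤ N := by exact_mod_cast hN
  have hJ0 : (0 : ℝ) ≤ J := J.cast_nonneg
  have h1 : (1 : ℝ) ≤ N * T := one_le_mul_of_one_le_of_one_le hN' hT'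
  have h3 : (3 : ℝ) ≤ 3 * peelConst T θ * N * T / 2 := by
    rw [hJ, show 3 * (2 * ((J : ℝ) + 1)) * N * T / 2 = 3 * ((J + 1) * (N * T)) by ring]
    have : 1 ≤ ((J : ℝ) + 1) * (N * T) := one_le_mul_of_one_le_of_one_le (by linarith) h1
    linarith
  rw [Real.le_log_iff_exp_le (by linarith)]
  exact Real.exp_one_lt_three.le.trans h3

theorem Model.Vmax_nonneg (M : Model N K) : 0 ≤ M.Vmax :=
  Real.iSup_nonneg fun d => totalAttraction_nonneg M.α_nonneg d

end Horizon

end PositionMNL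

end

/-! ### Choice of `η` and conclusion -/

theorem theorem1 (N K T : ℕ) (hKN : K ≤ N) (hT : 1 ≤ T) (M : PositionMNL.Model N K)
    (π : PositionMNL.Policy N K) (hπ : PositionMNL.IsP2MLEUCB T M.θ M.r π) :
    PositionMNL.regret M.r M.α M.α_nonneg T π ≤
      1 + N * max (2 * Real.log (3 * N * T ^ 2) * (1 + M.Vmax) ^ 2) (2 * K * (1 + M.Vmax))
        + PositionMNL.Ctilde N T M.θ * √(N * T) := by
  open PositionMNL in
  obtain ⟨k₀, _⟩ := M.θ_max
  have : Nonempty (Fin K) := ⟨k₀⟩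
  have hK : 1 ≤ K := by have := k₀.2; omega
  have hN : 1 ≤ N := hK.trans hKN
  have hN' : (1 : ℝ) ≤ N := by exact_mod_cast hN
  have hT' : (1 : ℝ) ≤ T := by exact_mod_cast hT
  have hK' : (1 : ℝ) ≤ K := by exact_mod_cast hK
  have hm : 0 < thetaMin M.θ := thetaMin_pos fun k => (M.θ_mem k).1
  have hm1 : thetaMin M.θ ≤ 1 := thetaMin_le_one fun k => (M.θ_mem k).2
  have hC₆ : 0 ≤ C₆ := by
    unfold C₆ C₄ C₁
    positivity
  have hC₇ : 1 ≤ C₇ := by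
    have : 0 ≤ C₄ * √C₃ := by
      unfold C₄ C₁
      positivity
    have : 0 ≤ 2 * C₁ * √C₂ := by
      unfold C₁
      positivity
    have : (1 : ℝ) ≤ C₁ ^ 2 + C₂ := by norm_num [C₁, C₂]
    have : 0 ≤ C₂ := by norm_num [C₂]
    unfold C₇ C₅
    linarith
  have hfirst : (N : ℝ)
      ≤ N * max (2 * Real.log (3 * N * T ^ 2) * (1 + M.Vmax) ^ 2) (2 * K * (1 + M.Vmax)) := by
    refine le_mul_of_one_le_right (by linarith) (le_trans ?_ (le_max_right _ _))
    have := M.Vmax_nonneg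
    nlinarith
  have hlogT : 0 ≤ Real.log T := Real.log_nonneg hT'
  have hL1 := one_le_log_peelConst M.θ_mem hN hT
  have hLdef := congrArg Real.log (peelConst_div_confidence N T M.θ)
  obtain ⟨J, hJ, hJT⟩ := exists_peelConst_eq M.θ_mem hT
  rw [Ctilde]
  -- The total failure probability over rounds and products is `2 / 3`, which the summand `1` of the
  -- bound covers.
  have hexp : T * (N * (2 * ((J : ℝ) + 1)
      * Real.exp (-Real.log (3 * peelConst T M.θ * N * T / 2)))) = 2 / 3 := by
    rw [Real.exp_neg, hJ, Real.exp_log (by positivity)]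
    field_simp
  set L := Real.log (3 * peelConst T M.θ * N * T / 2) with hLL
  set H := 1 + Real.log T with hH
  have hH1 : 1 ≤ H := by linarith
  have hrpow : (thetaMin M.θ) ^ (-(1 / 2) : ℝ) * √L = √(L / thetaMin M.θ) := by
    rw [Real.rpow_neg hm.le, ← Real.sqrt_eq_rpow, Real.sqrt_div (by linarith), div_eq_mul_inv,
      mul_comm]
  have hinv : (thetaMin M.θ)⁻¹ * L = L / thetaMin M.θ := by rw [div_eq_mul_inv, mul_comm]
  have hB1 : 1 ≤ L / thetaMin M.θ := by
    rw [one_le_div hm]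
    linarith
  rw [mul_assoc C₆, hrpow, mul_assoc C₇, hinv, mul_assoc _ √(2 * H),
    ← Real.sqrt_mul (by positivity)]
  set B := L / thetaMin M.θ with hB
  have hsq : 0 ≤ √(2 * H * (N * T)) := Real.sqrt_nonneg _
  have hC₆B : 0 ≤ C₆ * √B := by positivity
  have hC₇B : 1 ≤ C₇ * B := one_le_mul_of_one_le_of_one_le hC₇ hB1
  rcases le_total (N * H) (2 * T) with hlarge | hsmall
  -- This `η` balances `η T` against `N H / η`, both equal to `√(N H T)`; the case assumption bounds
  -- the remaining `N H` by `√(2 H N T)`.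
  · have hη : 0 < √(N * H / T) := Real.sqrt_pos.2 (by positivity)
    have hreg := regret_le_of_deviation hT M hπ (by linarith) hLdef hη hJT
    rw [hexp] at hreg
    have h1 : √(N * H / T) * T = √(N * H * T) := by
      rw [Real.sqrt_div (by positivity), Real.sqrt_mul (x := N * H) (by positivity),
        div_mul_eq_mul_div, mul_div_assoc, Real.div_sqrt]
    have h2 : (√(N * H / T))⁻¹ * (N * H) = √(N * H * T) := by
      rw [← Real.sqrt_inv, inv_div, Real.sqrt_div (by positivity),
        Real.sqrt_mul (x := N * H) (by positivity), div_mul_eq_mul_div, mul_div_assoc,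
        Real.div_sqrt, mul_comm]
    have h3 : √(N * H * T) ≤ √(2 * H * (N * T)) := Real.sqrt_le_sqrt (by
      have : 0 ≤ N * H * T := by positivity
      linarith)
    have h4 : N * H ≤ √(2 * H * (N * T)) := Real.le_sqrt_of_sq_le (by
      have := mul_le_mul_of_nonneg_left hlarge (show 0 ≤ N * H by positivity)
      linarith)
    have h5 : C₆ * √B * √(N * H / T) / 2 * T = C₆ * √B * √(N * H * T) / 2 := by
      rw [← h1]
      ring
    have h6 : (C₆ * √B * (√(N * H / T))⁻¹ / 2 + C₇ * B) * (N * H)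
        = C₆ * √B * √(N * H * T) / 2 + C₇ * B * (N * H) := by
      rw [← h2]
      ring
    have h7 := mul_le_mul_of_nonneg_left h3 hC₆B
    have h8 := mul_le_mul_of_nonneg_left h4 (show 0 ≤ C₇ * B by linarith)
    rw [h5, h6] at hreg
    linarith
  -- Short horizon: the regret is at most `T`, and `C₇ B ≥ 1`.
  · have h1 : (T : ℝ) ≤ √(2 * H * (N * T)) := Real.le_sqrt_of_sq_le (by
      have := mul_le_mul_of_nonneg_left hsmall (show (0 : ℝ) ≤ T by linarith)
      nlinarith)
    have h2 := mul_le_mul_of_nonneg_right hC₇B hsq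
    have h3 := mul_nonneg hC₆B hsq
    have h4 := regret_le_horizon M π T
    linarith
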